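/- For a finite set $I$ of positive integers let $(e_i)_{i\in I}$ be the standard basis of $\mathbb{F}_2^I$. A set $A\subseteq\mathbb{F}_2^I$ is a downset if, whenever $i\in I$, $x_i=0$ and $x+e_i\in A$, also $x\in A$. For non-empty $A$ put $\sigma[A]=|A+A|/|A|$. For real $K\ge 1$ let $G_{\mathrm D}(K)$ be the least real constant such that for every finite set $I$ of positive integers and every non-empty downset $A\subseteq\mathbb{F}_2^I$ with $\sigma[A]\le K$ there is a linear subspace $V\subseteq\mathbb{F}_2^I$ with $|V|\le|A|$ such that $A$ is covered by at most $G_{\mathrm D}(K)$ translates of $V$. Theorem. There are absolute constants $c,C>0$ such that for all real $K\ge 1$ the least constant $G_{\mathrm D}(K)$ exists (in particular is finite) and $$c\,K^{1.46601}\le G_{\mathrm D}(K)\le C\,K^{46}.$$ In particular, every non-empty downset $A\subseteq\mathbb{F}_2^I$, for any finite set $I$ of positive integers, is covered by at most $C\,\sigma[A]^{46}$ translates of some linear subspace of cardinality at most $|A|$. -/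

import Mathlib

open scoped Pointwise

/-- The vector space `𝔽₂^I` over a finite set `I` of positive integers. -/
abbrev F2Space (I : Finset ℕ+) : Type := I → ZMod 2

/-- The doubling constant `σ[A] = |A + A| / |A|` (used for non-empty `A` only). -/
noncomputable def doublingConst {I : Finset ℕ+} (A : Finset (F2Space I)) : ℝ :=
  ((A + A).card : ℝ) / (A.card : ℝ)

/-- `A ⊆ 𝔽₂^I` is a downset: whenever `i ∈ I`, `x i = 0` and `x + e_i ∈ A`, also `x ∈ A`. -/
def IsDownset {I : Finset ℕ+} (A : Finset (F2Space I)) : Prop :=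
  ∀ (i : I) (x : F2Space I), x i = 0 → x + Pi.single i 1 ∈ A → x ∈ A

/-- There is a linear subspace `V` with `|V| ≤ |A|` such that `A` is covered by at most `C`
translates `t + V` of `V`. -/
def CoveredByTranslates {I : Finset ℕ+} (A : Finset (F2Space I)) (C : ℝ) : Prop :=
  ∃ V : Submodule (ZMod 2) (F2Space I), Nat.card V ≤ A.card ∧
    ∃ T : Finset (F2Space I), (T.card : ℝ) ≤ C ∧
      (A : Set (F2Space I)) ⊆ ⋃ t ∈ T, t +ᵥ (V : Set (F2Space I))

/-- The constants that are admissible in the definition of `G_D(K)`: those real `C` such that,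
for every `I`, every non-empty downset `A ⊆ 𝔽₂^I` with `σ[A] ≤ K` is covered by at most `C`
translates of some linear subspace of cardinality at most `|A|`. -/
def admissibleConstants (K : ℝ) : Set ℝ :=
  {C | ∀ (I : Finset ℕ+) (A : Finset (F2Space I)),
    A.Nonempty → IsDownset A → doublingConst A ≤ K → CoveredByTranslates A C}

/-- `G_D(K)`, the least admissible constant. The infimum of real numbers takes a default value
on the empty set, so that the existence of a least admissible constant has to be asserted
separately, as `IsLeast (admissibleConstants K) (GD K)`. -/
noncomputable def GD (K : ℝ) : ℝ := sInf (admissibleConstants K)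

/-! Upper bound. Identify vectors with their supports, so that a downset becomes a down-closed
family `𝒜` and `A + A` contains all unions. Let `U i` be the entropy of coordinate `i` of a uniform
member given the earlier coordinates; these sum to `log |𝒜|`. In a down-closed family every
conditional bit has probability at most 1/2 of being 1, and for two independent such bits, with
entropies `u` and `v`, the sum has entropy at least the bi-affine `gainBound u v`. Being bi-affine,
this bound survives averaging over independent pasts, so `∑ gainBound (U i) (U i) ≤ log |A + A|`
(`sum_gainBound_le_logb_card_sups`).

Since `gainBound u u - u = 2u(1 - u)/45`, small doubling `K` forces most `U i` close to 0 or 1: `∑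
min (U i) (1 - U i) ≤ 45 log K`. With `J` the coordinates where `U i > 1/2`, the members inside `J`
number at least `|𝒜| / K^45` and at least `2^|J| / K^45` (`exists_two_pow_card_le`). Unions of such
members with traces outside `J` are distinct, so there are at most `K^46` traces; trimming `J` to
cardinality `log |𝒜|` costs a factor 2.

Lower bound. Take the Hamming ball of radius `119k` in dimension `1264k`. A subspace no larger than
the ball has dimension at most `569k`, hence a coordinate complement of dimension at least `695k`,
and the points of the ball in that complement lie in distinct translates. Comparing exponential
rates of binomial coefficients gives the exponent 1.46601. -/

open scoped Pointwise

/-! ### Binary entropy and Gibbs' inequality -/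

/-- The binary entropy function measured in bits. -/
noncomputable def bitEntropy (p : ℝ) : ℝ := Real.binEntropy p / Real.log 2

lemma bitEntropy_eq (p : ℝ) :
    bitEntropy p = -(p * Real.logb 2 p) - (1 - p) * Real.logb 2 (1 - p) := by
  simp only [bitEntropy, Real.binEntropy, Real.log_inv, Real.logb]
  ring

lemma bitEntropy_zero : bitEntropy 0 = 0 := by simp [bitEntropy]

lemma bitEntropy_nonneg {p : ℝ} (h₀ : 0 ≤ p) (h₁ : p ≤ 1) : 0 ≤ bitEntropy p :=
  div_nonneg (Real.binEntropy_nonneg h₀ h₁) (Real.log_nonneg one_le_two)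

lemma bitEntropy_le_one (p : ℝ) : bitEntropy p ≤ 1 :=
  (div_le_one (Real.log_pos one_lt_two)).2 Real.binEntropy_le_log_two

lemma bitEntropy_half : bitEntropy (1 / 2) = 1 := by
  rw [bitEntropy, one_div, Real.binEntropy_two_inv, div_self (Real.log_pos one_lt_two).ne']

lemma concaveOn_bitEntropy : ConcaveOn ℝ (Set.Icc 0 1) bitEntropy := by
  have h := Real.strictConcave_binEntropy.concaveOn.smul
    (inv_nonneg.2 (Real.log_nonneg one_le_two))
  have e : bitEntropy = fun p => (Real.log 2)⁻¹ • Real.binEntropy p := by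
    funext p
    simp [bitEntropy, div_eq_inv_mul]
  rw [e]
  exact h

lemma logb_two_le {x : ℝ} (hx : 0 < x) : Real.logb 2 x ≤ (x - 1) / Real.log 2 :=
  div_le_div_of_nonneg_right (Real.log_le_sub_one_of_pos hx) (Real.log_nonneg one_le_two)

lemma inv_log_two_bounds : 1.442 < 1 / Real.log 2 ∧ 1 / Real.log 2 < 1.443 := by
  have h1 := Real.log_two_gt_d9
  have h2 := Real.log_two_lt_d9
  have h3 : 0 < Real.log 2 := Real.log_pos one_lt_two
  constructor
  · rw [lt_div_iff₀ h3]
    linarith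
  · rw [div_lt_iff₀ h3]
    linarith

/-- One term of Gibbs' inequality. -/
lemma mul_logb_sub_logb_le {p x : ℝ} (hp : 0 ≤ p) (hx : 0 < p → 0 < x) :
    p * (Real.logb 2 x - Real.logb 2 p) ≤ (if p = 0 then 0 else x - p) / Real.log 2 := by
  rcases hp.eq_or_lt with rfl | hp'
  · simp
  · have hx' := hx hp'
    rw [if_neg hp'.ne', ← Real.logb_div hx'.ne' hp'.ne']
    have h := mul_le_mul_of_nonneg_left (logb_two_le (div_pos hx' hp')) hp
    have e : p * ((x / p - 1) / Real.log 2) = (x - p) / Real.log 2 := by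
      field_simp
    linarith

/-- Gibbs' inequality for a two-point distribution, in the form of the variational formula for
the logarithm of a sum. -/
lemma bitEntropy_add_le_logb_add {r x y : ℝ} (hr₀ : 0 ≤ r) (hr₁ : r ≤ 1) (hx₀ : 0 ≤ x)
    (hy₀ : 0 ≤ y) (hx : r < 1 → 0 < x) (hy : 0 < r → 0 < y) :
    bitEntropy r + (1 - r) * Real.logb 2 x + r * Real.logb 2 y ≤ Real.logb 2 (x + y) := by
  have hs : 0 < x + y := by
    rcases hr₁.lt_or_eq with h | h
    · linarith [hx h]
    · linarith [hy (by linarith)]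
  have hl : 0 < Real.log 2 := Real.log_pos one_lt_two
  have key : ∀ p z : ℝ, 0 ≤ p → 0 ≤ z → (0 < p → 0 < z) →
      p * (Real.logb 2 z - Real.logb 2 (x + y) - Real.logb 2 p) ≤
        (z / (x + y) - p) / Real.log 2 := by
    intro p z hp hz hpz
    rcases hp.eq_or_lt with rfl | hp'
    · simp only [zero_mul, sub_zero]
      positivity
    · have h := mul_logb_sub_logb_le hp (x := z / (x + y)) fun _ => div_pos (hpz hp') hs
      rwa [if_neg hp'.ne', Real.logb_div (hpz hp').ne' hs.ne'] at h
  have h1 := key r y hr₀ hy₀ hy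
  have h2 := key (1 - r) x (by linarith) hx₀ fun h => hx (by linarith)
  have e : (y / (x + y) - r) / Real.log 2 + (x / (x + y) - (1 - r)) / Real.log 2 = 0 := by
    field_simp
    ring
  rw [bitEntropy_eq]
  linarith

/-- The chain rule for the entropy of a uniform element of a disjoint union. -/
lemma logb_add_eq {x y : ℝ} (hx : 0 ≤ x) (hy : 0 ≤ y) :
    Real.logb 2 (x + y) = bitEntropy (y / (x + y)) + (1 - y / (x + y)) * Real.logb 2 x +
      y / (x + y) * Real.logb 2 y := by
  rcases hx.eq_or_lt with rfl | hx'
  · rcases hy.eq_or_lt with rfl | hy'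
    · simp [bitEntropy]
    · simp [div_self hy'.ne', bitEntropy]
  rcases hy.eq_or_lt with rfl | hy'
  · simp [bitEntropy]
  have hs : 0 < x + y := by positivity
  have e : 1 - y / (x + y) = x / (x + y) := by
    field_simp
    ring
  rw [bitEntropy_eq, e, Real.logb_div hx'.ne' hs.ne', Real.logb_div hy'.ne' hs.ne']
  field_simp
  ring

/-- The tangent to the entropy function at `r` lies above its graph. -/
lemma bitEntropy_le_tangent {p r : ℝ} (hp₀ : 0 ≤ p) (hp₁ : p ≤ 1) (hr₀ : 0 < r) (hr₁ : r < 1) :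
    bitEntropy p ≤ bitEntropy r - (r - p) * Real.logb 2 ((1 - r) / r) := by
  have h := bitEntropy_add_le_logb_add hp₀ hp₁ (x := 1 - r) (y := r) (by linarith) hr₀.le
    (fun _ => by linarith) (fun _ => hr₀)
  rw [sub_add_cancel, Real.logb_one] at h
  rw [Real.logb_div (by linarith) hr₀.ne', bitEntropy_eq r]
  linarith

/-- The term `(1 - p) log (1 / (1 - p))` is at most `p / ln 2`, by `log x ≤ x - 1`; the same
inequality applied to `1 - p` gives the companion lower bound `le_bitEntropy`. -/
lemma bitEntropy_le {p : ℝ} (hp₀ : 0 < p) (hp₁ : p < 1) :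
    bitEntropy p ≤ p * (Real.logb 2 (1 / p) + 1.443) := by
  have h := logb_two_le (inv_pos.2 (sub_pos.2 hp₁))
  have h2 := mul_le_mul_of_nonneg_left h (sub_pos.2 hp₁).le
  have e : (1 - p) * (((1 - p)⁻¹ - 1) / Real.log 2) = p * (1 / Real.log 2) := by
    have : 1 - p ≠ 0 := by linarith
    field_simp
    ring
  rw [Real.logb_inv, e] at h2
  have h3 := mul_le_mul_of_nonneg_left inv_log_two_bounds.2.le hp₀.le
  rw [bitEntropy_eq, one_div, Real.logb_inv]
  linarith

lemma le_bitEntropy {p : ℝ} (hp₀ : 0 < p) (hp₁ : p < 1) :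
    p * (Real.logb 2 (1 / p) + 1.442 * (1 - p)) ≤ bitEntropy p := by
  have h := mul_le_mul_of_nonneg_left (logb_two_le (sub_pos.2 hp₁)) (sub_pos.2 hp₁).le
  have e : (1 - p) * ((1 - p - 1) / Real.log 2) = -(p * (1 - p) * (1 / Real.log 2)) := by ring
  have h3 := mul_le_mul_of_nonneg_left inv_log_two_bounds.1.le
    (mul_nonneg hp₀.le (sub_pos.2 hp₁).le)
  rw [bitEntropy_eq, one_div, Real.logb_inv]
  linarith

/-! ### Entropy of a sum of two independent bits -/

/-- The bi-affine lower bound for the entropy of a sum of two independent bits in terms of their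
entropies. -/
noncomputable def gainBound (u v : ℝ) : ℝ := (u + v) / 2 + (u + v - 2 * u * v) / 45

lemma gainBound_comm (u v : ℝ) : gainBound u v = gainBound v u := by
  unfold gainBound
  ring

lemma logb_two_pow (n : ℕ) : Real.logb 2 (2 ^ n) = n := by
  rw [Real.logb_pow, Real.logb_self_eq_one one_lt_two, mul_one]

lemma gainBound_le_bitEntropy_of_le {p q : ℝ} (hq₀ : 0 ≤ q) (hqp : q ≤ p) (hp : p ≤ 1 / 2) :
    gainBound (bitEntropy p) (bitEntropy q) ≤ bitEntropy (p + q - 2 * p * q) := by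
  have hu₁ := bitEntropy_le_one p
  have hv₁ := bitEntropy_le_one q
  have hu₀ := bitEntropy_nonneg (hq₀.trans hqp) (by linarith : p ≤ 1)
  have hv₀ := bitEntropy_nonneg hq₀ (by linarith : q ≤ 1)
  -- the chord from `p` to `1 / 2`
  have chord : bitEntropy p + 2 * q * (1 - bitEntropy p) ≤ bitEntropy (p + q - 2 * p * q) := by
    have h := concaveOn_bitEntropy.2 (show p ∈ Set.Icc (0 : ℝ) 1 from ⟨hq₀.trans hqp, by linarith⟩)
      (show (1 / 2 : ℝ) ∈ Set.Icc (0 : ℝ) 1 from ⟨by norm_num, by norm_num⟩)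
      (show 0 ≤ 1 - 2 * q by linarith) (show 0 ≤ 2 * q by linarith) (by ring)
    simp only [smul_eq_mul, bitEntropy_half] at h
    have e : (1 - 2 * q) * p + 2 * q * (1 / 2) = p + q - 2 * p * q := by ring
    rw [e] at h
    linarith
  have chord' : bitEntropy p ≤ bitEntropy (p + q - 2 * p * q) := by nlinarith
  rcases hq₀.eq_or_lt with rfl | hq
  · simp only [mul_zero, sub_zero, add_zero, bitEntropy_zero, gainBound]
    linarith
  have hp₀ : 0 < p := hq.trans_le hqp
  have hL : 1 ≤ Real.logb 2 (1 / p) := by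
    rw [Real.le_logb_iff_rpow_le one_lt_two (by positivity), Real.rpow_one, le_div_iff₀ hp₀]
    linarith
  set u := bitEntropy p with hu
  set v := bitEntropy q with hv
  set L := Real.logb 2 (1 / p) with hLdef
  -- Here `(u + v) / 2 ≤ 0.95 u` leaves room for the gain term, so `chord'` suffices.
  by_cases hcase : v ≤ 9 / 10 * u
  · unfold gainBound
    nlinarith
  -- now `q` is comparable to `p`
  have hq4 : p / 4 < q := by
    by_contra! hle
    apply hcase
    have mono : v ≤ bitEntropy (p / 4) :=
      div_le_div_of_nonneg_right (Real.binEntropy_strictMonoOn.monotoneOn ⟨hq₀, by norm_num; linarith⟩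
        ⟨by linarith, by norm_num; linarith⟩ hle) (Real.log_nonneg one_le_two)
    have h1 := bitEntropy_le (p := p / 4) (by linarith) (by linarith)
    have h2 := le_bitEntropy hp₀ (by linarith)
    have e : Real.logb 2 (1 / (p / 4)) = L + 2 := by
      have : (1 : ℝ) / (p / 4) = (1 / p) * 2 ^ 2 := by
        field_simp
        norm_num
      rw [this, Real.logb_mul (by positivity) (by positivity), logb_two_pow, ← hLdef, Nat.cast_ofNat]
    rw [e] at h1
    nlinarith
  have main : (2 / 45) * u * (1 - u) ≤ bitEntropy (p + q - 2 * p * q) - u := by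
    have hub := bitEntropy_le hp₀ (by linarith)
    rw [← hu, ← hLdef] at hub
    -- For `p ≥ 1/16`, `u` is at most `5.443 p` and the chord suffices because `2q > p/2`. For
    -- smaller `p` the entropy is of order `p log (1/p)`, which the chord misses; the tangent at `r`
    -- has slope at least `L - 2` in absolute value and `r - p ≥ 7p/32`.
    rcases le_total (1 / 16) p with hbig | hsmall
    · have hL4 : L ≤ 4 := by
        rw [hLdef, Real.logb_le_iff_le_rpow one_lt_two (by positivity), div_le_iff₀ hp₀]
        norm_num
        linarith
      have h1 : 2 / 45 * u ≤ 2 * q := by nlinarith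
      nlinarith [mul_le_mul_of_nonneg_right h1 (sub_nonneg.2 hu₁)]
    · have hL4 : 4 ≤ L := by
        rw [hLdef, Real.le_logb_iff_rpow_le one_lt_two (by positivity), le_div_iff₀ hp₀]
        norm_num
        linarith
      set r := p + q - 2 * p * q with hr
      have hr₀ : 0 < r := by nlinarith
      have hr₂ : r ≤ 2 * p := by nlinarith
      have ht := bitEntropy_le_tangent hp₀.le (by linarith : p ≤ 1) hr₀ (by linarith)
      have hslope : L - 2 ≤ Real.logb 2 ((1 - r) / r) := by
        have e : Real.logb 2 (1 / (4 * p)) = L - 2 := by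
          have : (1 : ℝ) / (4 * p) = (1 / p) / 2 ^ 2 := by
            field_simp
            norm_num
          rw [this, Real.logb_div (by positivity) (by positivity), logb_two_pow, ← hLdef,
            Nat.cast_ofNat]
        rw [← e]
        apply Real.logb_le_logb_of_le one_lt_two (by positivity)
        rw [div_le_div_iff₀ (by positivity) hr₀]
        nlinarith
      have hrp : p * (7 / 32) ≤ r - p := by nlinarith
      have h2 : p * (7 / 32) * (L - 2) ≤ (r - p) * Real.logb 2 ((1 - r) / r) :=
        mul_le_mul hrp hslope (by linarith) (by nlinarith)
      have h3 : (2 / 45) * u ≤ p * (7 / 32) * (L - 2) := by nlinarith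
      nlinarith
  unfold gainBound
  -- `gainBound u` is increasing, so `v` may be replaced by `u`; then `main` is the claim.
  have huv : v ≤ u :=
    div_le_div_of_nonneg_right (Real.binEntropy_strictMonoOn.monotoneOn
      ⟨hq₀, by norm_num; linarith⟩ ⟨by linarith, by norm_num; linarith⟩ hqp)
      (Real.log_nonneg one_le_two)
  nlinarith [mul_nonneg (sub_nonneg.2 huv) (sub_nonneg.2 hu₁), mul_nonneg (sub_nonneg.2 huv) hu₀]

theorem gainBound_le_bitEntropy {p q : ℝ} (hp₀ : 0 ≤ p) (hp : p ≤ 1 / 2) (hq₀ : 0 ≤ q)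
    (hq : q ≤ 1 / 2) :
    gainBound (bitEntropy p) (bitEntropy q) ≤ bitEntropy (p + q - 2 * p * q) := by
  rcases le_total q p with h | h
  · exact gainBound_le_bitEntropy_of_le hq₀ h hp
  · have := gainBound_le_bitEntropy_of_le hp₀ h hq
    rwa [gainBound_comm, add_comm q p, mul_right_comm] at this

/-! ### Conditional entropies in down-closed families -/

section SetFamily

open Finset FinsetFamily

variable {α : Type*} [DecidableEq α]

/-- The proportion of members of `𝒜` that contain `a`. -/
noncomputable def memberFreq (a : α) (𝒜 : Finset (Finset α)) : ℝ :=
  (#(𝒜.memberSubfamily a) : ℝ) / #𝒜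

/-- For a uniformly random member of `𝒜`, `condEntropy l 𝒜 i` is the conditional entropy, in bits,
of the event that it contains `i`, given which of the elements before `i` in the list `l` it
contains. -/
noncomputable def condEntropy : List α → Finset (Finset α) → α → ℝ
  | [], _, _ => 0
  | a :: l, 𝒜, i =>
    if i = a then bitEntropy (memberFreq a 𝒜)
    else (1 - memberFreq a 𝒜) * condEntropy l (𝒜.nonMemberSubfamily a) i +
      memberFreq a 𝒜 * condEntropy l (𝒜.memberSubfamily a) i

lemma card_eq_add (a : α) (𝒜 : Finset (Finset α)) :
    (#𝒜 : ℝ) = #(𝒜.nonMemberSubfamily a) + #(𝒜.memberSubfamily a) := by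
  rw [← card_memberSubfamily_add_card_nonMemberSubfamily a 𝒜]
  push_cast
  ring

lemma memberFreq_nonneg (a : α) (𝒜 : Finset (Finset α)) : 0 ≤ memberFreq a 𝒜 := by
  unfold memberFreq
  positivity

lemma memberFreq_le_one (a : α) (𝒜 : Finset (Finset α)) : memberFreq a 𝒜 ≤ 1 := by
  apply div_le_one_of_le₀ _ (by positivity)
  rw [card_eq_add a 𝒜]
  linarith [(#(𝒜.nonMemberSubfamily a)).cast_nonneg (α := ℝ)]

lemma memberSubfamily_nonempty_of_memberFreq_pos {a : α} {𝒜 : Finset (Finset α)}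
    (h : 0 < memberFreq a 𝒜) : (𝒜.memberSubfamily a).Nonempty := by
  rw [nonempty_iff_ne_empty]
  rintro h'
  simp [memberFreq, h'] at h

lemma condEntropy_mem_Icc (l : List α) (𝒜 : Finset (Finset α)) (i : α) :
    condEntropy l 𝒜 i ∈ Set.Icc (0 : ℝ) 1 := by
  induction l generalizing 𝒜 with
  | nil => simp [condEntropy]
  | cons a l ih =>
    have h₀ := memberFreq_nonneg a 𝒜
    have h₁ := memberFreq_le_one a 𝒜
    rw [condEntropy]
    split_ifs
    · exact ⟨bitEntropy_nonneg h₀ h₁, bitEntropy_le_one _⟩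
    · exact convex_Icc (0 : ℝ) 1 (ih (𝒜.nonMemberSubfamily a)) (ih (𝒜.memberSubfamily a))
        (sub_nonneg.2 h₁) h₀ (by ring)

lemma subset_of_mem_nonMemberSubfamily {a : α} {l : List α} {𝒜 : Finset (Finset α)}
    (h : ∀ s ∈ 𝒜, ∀ i ∈ s, i ∈ a :: l) : ∀ s ∈ 𝒜.nonMemberSubfamily a, ∀ i ∈ s, i ∈ l := by
  intro s hs i hi
  rw [mem_nonMemberSubfamily] at hs
  rcases List.mem_cons.1 (h s hs.1 i hi) with rfl | h'
  · exact absurd hi hs.2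
  · exact h'

lemma subset_of_mem_memberSubfamily {a : α} {l : List α} {𝒜 : Finset (Finset α)}
    (h : ∀ s ∈ 𝒜, ∀ i ∈ s, i ∈ a :: l) : ∀ s ∈ 𝒜.memberSubfamily a, ∀ i ∈ s, i ∈ l := by
  intro s hs i hi
  rw [mem_memberSubfamily] at hs
  rcases List.mem_cons.1 (h _ hs.1 i (mem_insert_of_mem hi)) with rfl | h'
  · exact absurd hi hs.2
  · exact h'

/-- A weighted sum of the values of `condEntropy` on the two subfamilies determined by the first
element of the list, as a sum over the remaining elements. -/
lemma sum_map_condEntropy_cons {a : α} {l : List α} (ha : a ∉ l) (𝒜 : Finset (Finset α))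
    (F : α → ℝ → ℝ) :
    (l.map fun i => F i (condEntropy (a :: l) 𝒜 i)).sum =
      (l.map fun i => F i ((1 - memberFreq a 𝒜) * condEntropy l (𝒜.nonMemberSubfamily a) i +
        memberFreq a 𝒜 * condEntropy l (𝒜.memberSubfamily a) i)).sum := by
  congr 1
  apply List.map_congr_left
  intro i hi
  rw [condEntropy, if_neg (ne_of_mem_of_not_mem hi ha)]

lemma condEntropy_cons_self (a : α) (l : List α) (𝒜 : Finset (Finset α)) :
    condEntropy (a :: l) 𝒜 a = bitEntropy (memberFreq a 𝒜) := by
  rw [condEntropy, if_pos rfl]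

lemma logb_card_eq (a : α) (𝒜 : Finset (Finset α)) :
    Real.logb 2 #𝒜 = bitEntropy (memberFreq a 𝒜) +
      (1 - memberFreq a 𝒜) * Real.logb 2 #(𝒜.nonMemberSubfamily a) +
      memberFreq a 𝒜 * Real.logb 2 #(𝒜.memberSubfamily a) := by
  unfold memberFreq
  rw [card_eq_add a 𝒜]
  exact logb_add_eq (Nat.cast_nonneg _) (Nat.cast_nonneg _)

lemma eq_empty_or_singleton_empty {α : Type*} {𝒜 : Finset (Finset α)}
    (h : ∀ s ∈ 𝒜, ∀ i ∈ s, i ∈ ([] : List α)) : 𝒜 = ∅ ∨ 𝒜 = {∅} := by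
  rw [← subset_singleton_iff]
  intro s hs
  rw [mem_singleton, eq_empty_iff_forall_notMem]
  intro i hi
  exact absurd (h s hs i hi) List.not_mem_nil

lemma List.sum_map_lin {α : Type*} (l : List α) (x y : ℝ) (f g : α → ℝ) :
    (l.map fun i => x * f i + y * g i).sum = x * (l.map f).sum + y * (l.map g).sum := by
  rw [List.sum_map_add, List.sum_map_mul_left, List.sum_map_mul_left]

/-- The chain rule: the conditional entropies add up to the entropy of the uniform distribution. -/
lemma sum_condEntropy {l : List α} (hl : l.Nodup) {𝒜 : Finset (Finset α)}
    (h : ∀ s ∈ 𝒜, ∀ i ∈ s, i ∈ l) : (l.map (condEntropy l 𝒜)).sum = Real.logb 2 #𝒜 := by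
  induction l generalizing 𝒜 with
  | nil => rcases eq_empty_or_singleton_empty h with rfl | rfl <;> simp
  | cons a l ih =>
    rw [List.nodup_cons] at hl
    rw [List.map_cons, List.sum_cons, condEntropy_cons_self, logb_card_eq a 𝒜,
      sum_map_condEntropy_cons hl.1 𝒜 fun _ x => x, List.sum_map_lin,
      ih hl.2 (subset_of_mem_nonMemberSubfamily h), ih hl.2 (subset_of_mem_memberSubfamily h)]
    ring

lemma IsLowerSet.nonMemberSubfamily_nonempty {𝒜 : Finset (Finset α)}
    (h : IsLowerSet (𝒜 : Set (Finset α))) (hne : 𝒜.Nonempty) (a : α) :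
    (𝒜.nonMemberSubfamily a).Nonempty := by
  obtain ⟨s, hs⟩ := hne
  exact ⟨s.erase a, mem_nonMemberSubfamily.2 ⟨h (erase_subset a s) hs, notMem_erase a s⟩⟩

lemma IsLowerSet.memberFreq_le_half {𝒜 : Finset (Finset α)}
    (h : IsLowerSet (𝒜 : Set (Finset α))) (a : α) : memberFreq a 𝒜 ≤ 1 / 2 := by
  rcases 𝒜.eq_empty_or_nonempty with rfl | hne
  · simp [memberFreq]
  · have h1 : (#(𝒜.memberSubfamily a) : ℝ) ≤ #(𝒜.nonMemberSubfamily a) := by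
      exact_mod_cast card_le_card h.memberSubfamily_subset_nonMemberSubfamily
    have h2 : (0 : ℝ) < #𝒜 := by exact_mod_cast hne.card_pos
    rw [memberFreq, div_le_div_iff₀ h2 two_pos]
    rw [card_eq_add a 𝒜] at *
    linarith

lemma nonMemberSubfamily_sups_subset (a : α) (𝒜 ℬ : Finset (Finset α)) :
    𝒜.nonMemberSubfamily a ⊻ ℬ.nonMemberSubfamily a ⊆ (𝒜 ⊻ ℬ).nonMemberSubfamily a := by
  intro u hu
  obtain ⟨s, hs, t, ht, rfl⟩ := mem_sups.1 hu
  rw [mem_nonMemberSubfamily] at hs ht ⊢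
  refine ⟨sup_mem_sups hs.1 ht.1, ?_⟩
  simp [hs.2, ht.2]

lemma memberSubfamily_sups_nonMemberSubfamily_subset (a : α) (𝒜 ℬ : Finset (Finset α)) :
    𝒜.memberSubfamily a ⊻ ℬ.nonMemberSubfamily a ⊆ (𝒜 ⊻ ℬ).memberSubfamily a := by
  intro u hu
  obtain ⟨s, hs, t, ht, rfl⟩ := mem_sups.1 hu
  rw [mem_memberSubfamily] at hs ⊢
  rw [mem_nonMemberSubfamily] at ht
  refine ⟨mem_sups.2 ⟨_, hs.1, _, ht.1, ?_⟩, ?_⟩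
  · rw [sup_eq_union, sup_eq_union, insert_union]
  · simp [hs.2, ht.2]

lemma nonMemberSubfamily_sups_memberSubfamily_subset (a : α) (𝒜 ℬ : Finset (Finset α)) :
    𝒜.nonMemberSubfamily a ⊻ ℬ.memberSubfamily a ⊆ (𝒜 ⊻ ℬ).memberSubfamily a := by
  rw [sups_comm, sups_comm 𝒜]
  exact memberSubfamily_sups_nonMemberSubfamily_subset a ℬ 𝒜

/-- Replacing the pairs of fibres by sumsets: the inductive step for the entropy bound. -/
lemma bitEntropy_add_le_logb_card_sups {𝒜 ℬ : Finset (Finset α)} (a : α)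
    (h𝒜 : IsLowerSet (𝒜 : Set (Finset α))) (hℬ : IsLowerSet (ℬ : Set (Finset α)))
    (hA : 𝒜.Nonempty) (hB : ℬ.Nonempty) {p q x₀₀ x₀₁ x₁₀ x₁₁ : ℝ} (hp : p = memberFreq a 𝒜)
    (hq : q = memberFreq a ℬ)
    (h₀₀ : x₀₀ ≤ Real.logb 2 #(𝒜.nonMemberSubfamily a ⊻ ℬ.nonMemberSubfamily a))
    (h₀₁ : 0 < q → x₀₁ ≤ Real.logb 2 #(𝒜.nonMemberSubfamily a ⊻ ℬ.memberSubfamily a))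
    (h₁₀ : 0 < p → x₁₀ ≤ Real.logb 2 #(𝒜.memberSubfamily a ⊻ ℬ.nonMemberSubfamily a))
    (h₁₁ : 0 < p → 0 < q → x₁₁ ≤ Real.logb 2 #(𝒜.memberSubfamily a ⊻ ℬ.memberSubfamily a)) :
    bitEntropy (p + q - 2 * p * q) + (1 - p) * (1 - q) * x₀₀ + (1 - p) * q * x₀₁ +
      p * (1 - q) * x₁₀ + p * q * x₁₁ ≤ Real.logb 2 #(𝒜 ⊻ ℬ) := by
  have hp₀ : 0 ≤ p := hp ▸ memberFreq_nonneg a 𝒜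
  have hq₀ : 0 ≤ q := hq ▸ memberFreq_nonneg a ℬ
  have hp₁ : p ≤ 1 / 2 := hp ▸ h𝒜.memberFreq_le_half a
  have hq₁ : q ≤ 1 / 2 := hq ▸ hℬ.memberFreq_le_half a
  have hA₁ : 0 < p → (𝒜.memberSubfamily a).Nonempty := fun h =>
    memberSubfamily_nonempty_of_memberFreq_pos (hp ▸ h)
  have hB₁ : 0 < q → (ℬ.memberSubfamily a).Nonempty := fun h =>
    memberSubfamily_nonempty_of_memberFreq_pos (hq ▸ h)
  have hA₀ := h𝒜.nonMemberSubfamily_nonempty hA a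
  have hB₀ := hℬ.nonMemberSubfamily_nonempty hB a
  have mono : ∀ {𝒞 𝒟 ℰ : Finset (Finset α)}, 𝒞.Nonempty → 𝒟.Nonempty → 𝒞 ⊻ 𝒟 ⊆ ℰ →
      Real.logb 2 #(𝒞 ⊻ 𝒟) ≤ Real.logb 2 #ℰ := by
    intro 𝒞 𝒟 ℰ h1 h2 h3
    apply Real.logb_le_logb_of_le one_lt_two
    · exact_mod_cast (h1.sups h2).card_pos
    · exact_mod_cast card_le_card h3
  have pos : ∀ {𝒞 𝒟 ℰ : Finset (Finset α)}, 𝒞.Nonempty → 𝒟.Nonempty → 𝒞 ⊻ 𝒟 ⊆ ℰ →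
      (0 : ℝ) < #ℰ := by
    intro 𝒞 𝒟 ℰ h1 h2 h3
    exact_mod_cast ((h1.sups h2).mono h3).card_pos
  have s₀₀ := nonMemberSubfamily_sups_subset a 𝒜 ℬ
  have s₁₀ := memberSubfamily_sups_nonMemberSubfamily_subset a 𝒜 ℬ
  have s₀₁ := nonMemberSubfamily_sups_memberSubfamily_subset a 𝒜 ℬ
  -- This replaces `1 + 1 = 0`: down-closedness puts unions of two member fibres back in the part
  -- avoiding `a`, which therefore carries weight `1 - (p + q - 2pq)`.
  have s₁₁ := (sups_subset h𝒜.memberSubfamily_subset_nonMemberSubfamily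
    hℬ.memberSubfamily_subset_nonMemberSubfamily).trans s₀₀
  have hr₀ : 0 ≤ p + q - 2 * p * q := by nlinarith
  have hr₁ : p + q - 2 * p * q ≤ 1 := by nlinarith
  have key := bitEntropy_add_le_logb_add (x := #((𝒜 ⊻ ℬ).nonMemberSubfamily a))
    (y := #((𝒜 ⊻ ℬ).memberSubfamily a)) hr₀ hr₁ (Nat.cast_nonneg _) (Nat.cast_nonneg _)
    (fun _ => pos hA₀ hB₀ s₀₀) (by
      intro h
      rcases hp₀.eq_or_lt with h' | h'
      · exact pos hA₀ (hB₁ (by rw [← h'] at h; linarith)) s₀₁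
      · exact pos (hA₁ h') hB₀ s₁₀)
  rw [← card_eq_add] at key
  have e₀₀ := mul_le_mul_of_nonneg_left (h₀₀.trans (mono hA₀ hB₀ s₀₀))
    (mul_nonneg (by linarith : 0 ≤ 1 - p) (by linarith : 0 ≤ 1 - q))
  -- An empty member fibre has frequency zero, so the meaningless logarithm carries no weight;
  -- likewise below.
  have e₀₁ : (1 - p) * q * x₀₁ ≤ (1 - p) * q * Real.logb 2 #((𝒜 ⊻ ℬ).memberSubfamily a) := by
    rcases hq₀.eq_or_lt with h | h
    · simp [← h]
    · exact mul_le_mul_of_nonneg_left ((h₀₁ h).trans (mono hA₀ (hB₁ h) s₀₁))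
        (mul_nonneg (by linarith) hq₀)
  have e₁₀ : p * (1 - q) * x₁₀ ≤ p * (1 - q) * Real.logb 2 #((𝒜 ⊻ ℬ).memberSubfamily a) := by
    rcases hp₀.eq_or_lt with h | h
    · simp [← h]
    · exact mul_le_mul_of_nonneg_left ((h₁₀ h).trans (mono (hA₁ h) hB₀ s₁₀))
        (mul_nonneg hp₀ (by linarith))
  have e₁₁ : p * q * x₁₁ ≤ p * q * Real.logb 2 #((𝒜 ⊻ ℬ).nonMemberSubfamily a) := by
    rcases hp₀.eq_or_lt with h | h
    · simp [← h]
    rcases hq₀.eq_or_lt with h' | h'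
    · simp [← h']
    · exact mul_le_mul_of_nonneg_left ((h₁₁ h h').trans (mono (hA₁ h) (hB₁ h') s₁₁))
        (mul_nonneg hp₀ hq₀)
  linarith

/-- This is what lets the pointwise entropy bound pass through the induction: the four pairs of
fibres recombine exactly into the averaged conditional entropies. -/
lemma gainBound_lin (p q u₀ u₁ v₀ v₁ : ℝ) :
    gainBound ((1 - p) * u₀ + p * u₁) ((1 - q) * v₀ + q * v₁) =
      (1 - p) * (1 - q) * gainBound u₀ v₀ + (1 - p) * q * gainBound u₀ v₁ +
        p * (1 - q) * gainBound u₁ v₀ + p * q * gainBound u₁ v₁ := by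
  unfold gainBound
  ring

/-- A lower bound for the number of unions of members of two down-closed families in terms of the
conditional entropies. -/
lemma sum_gainBound_le_logb_card_sups {l : List α} (hl : l.Nodup) {𝒜 ℬ : Finset (Finset α)}
    (h𝒜 : IsLowerSet (𝒜 : Set (Finset α))) (hℬ : IsLowerSet (ℬ : Set (Finset α)))
    (hA : 𝒜.Nonempty) (hB : ℬ.Nonempty) (sA : ∀ s ∈ 𝒜, ∀ i ∈ s, i ∈ l)
    (sB : ∀ s ∈ ℬ, ∀ i ∈ s, i ∈ l) :
    (l.map fun i => gainBound (condEntropy l 𝒜 i) (condEntropy l ℬ i)).sum ≤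
      Real.logb 2 #(𝒜 ⊻ ℬ) := by
  induction l generalizing 𝒜 ℬ with
  | nil =>
    apply Real.logb_nonneg one_lt_two
    exact_mod_cast (hA.sups hB).card_pos
  | cons a l ih =>
    rw [List.nodup_cons] at hl
    have hA₀ := h𝒜.nonMemberSubfamily_nonempty hA a
    have hB₀ := hℬ.nonMemberSubfamily_nonempty hB a
    have sA₀ := subset_of_mem_nonMemberSubfamily sA
    have sB₀ := subset_of_mem_nonMemberSubfamily sB
    have sA₁ := subset_of_mem_memberSubfamily sA
    have sB₁ := subset_of_mem_memberSubfamily sB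
    have step := bitEntropy_add_le_logb_card_sups a h𝒜 hℬ hA hB rfl rfl
      (ih hl.2 h𝒜.nonMemberSubfamily hℬ.nonMemberSubfamily hA₀ hB₀ sA₀ sB₀)
      (fun h => ih hl.2 h𝒜.nonMemberSubfamily hℬ.memberSubfamily hA₀
        (memberSubfamily_nonempty_of_memberFreq_pos h) sA₀ sB₁)
      (fun h => ih hl.2 h𝒜.memberSubfamily hℬ.nonMemberSubfamily
        (memberSubfamily_nonempty_of_memberFreq_pos h) hB₀ sA₁ sB₀)
      (fun h h' => ih hl.2 h𝒜.memberSubfamily hℬ.memberSubfamily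
        (memberSubfamily_nonempty_of_memberFreq_pos h)
        (memberSubfamily_nonempty_of_memberFreq_pos h') sA₁ sB₁)
    have pt := gainBound_le_bitEntropy (memberFreq_nonneg a 𝒜) (h𝒜.memberFreq_le_half a)
      (memberFreq_nonneg a ℬ) (hℬ.memberFreq_le_half a)
    rw [List.map_cons, List.sum_cons, condEntropy_cons_self, condEntropy_cons_self,
      sum_map_condEntropy_cons hl.1 𝒜 fun i x => gainBound x (condEntropy (a :: l) ℬ i),
      sum_map_condEntropy_cons hl.1 ℬ fun i x => gainBound _ x]
    simp only [gainBound_lin, List.sum_map_add, List.sum_map_mul_left]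
    linarith

/-- The members of a down-closed family that are contained in `J` are many if the conditional
entropies outside `J` are small. -/
lemma logb_card_sub_logb_card_filter_le {l : List α} (hl : l.Nodup) {𝒜 : Finset (Finset α)}
    (h𝒜 : IsLowerSet (𝒜 : Set (Finset α))) (hA : 𝒜.Nonempty) (sA : ∀ s ∈ 𝒜, ∀ i ∈ s, i ∈ l)
    (J : Finset α) :
    Real.logb 2 #𝒜 - Real.logb 2 #{s ∈ 𝒜 | s ⊆ J} ≤
      (l.map fun i => if i ∈ J then 0 else condEntropy l 𝒜 i).sum := by
  induction l generalizing 𝒜 with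
  | nil =>
    rcases eq_empty_or_singleton_empty sA with rfl | rfl
    · simp
    · rw [filter_true_of_mem (by simp)]
      simp
  | cons a l ih =>
    rw [List.nodup_cons] at hl
    have hA₀ := h𝒜.nonMemberSubfamily_nonempty hA a
    have h₀ := ih hl.2 h𝒜.nonMemberSubfamily hA₀ (subset_of_mem_nonMemberSubfamily sA)
    have h₁ := fun h : 0 < memberFreq a 𝒜 => ih hl.2 h𝒜.memberSubfamily
      (memberSubfamily_nonempty_of_memberFreq_pos h) (subset_of_mem_memberSubfamily sA)
    have empty_mem : ∀ {ℬ : Finset (Finset α)}, IsLowerSet (ℬ : Set (Finset α)) → ℬ.Nonempty →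
        (0 : ℝ) < #{s ∈ ℬ | s ⊆ J} := by
      intro ℬ hℬ ⟨s, hs⟩
      exact_mod_cast card_pos.2 ⟨∅, mem_filter.2 ⟨hℬ (empty_subset s) hs, empty_subset J⟩⟩
    have hp₀ := memberFreq_nonneg a 𝒜
    have hp₁ := memberFreq_le_one a 𝒜
    have chain := logb_card_eq a 𝒜
    rw [List.map_cons, List.sum_cons, condEntropy_cons_self,
      sum_map_condEntropy_cons hl.1 𝒜 fun i x => if i ∈ J then 0 else x]
    have split : (l.map fun i => if i ∈ J then 0 else
        (1 - memberFreq a 𝒜) * condEntropy l (𝒜.nonMemberSubfamily a) i +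
          memberFreq a 𝒜 * condEntropy l (𝒜.memberSubfamily a) i).sum =
        (1 - memberFreq a 𝒜) *
          (l.map fun i => if i ∈ J then 0 else condEntropy l (𝒜.nonMemberSubfamily a) i).sum +
        memberFreq a 𝒜 *
          (l.map fun i => if i ∈ J then 0 else condEntropy l (𝒜.memberSubfamily a) i).sum := by
      rw [← List.sum_map_lin]
      congr 1
      apply List.map_congr_left
      intro i _
      split_ifs <;> simp
    rw [split]
    have e₀ := mul_le_mul_of_nonneg_left h₀ (sub_nonneg.2 hp₁)
    have e₁ : memberFreq a 𝒜 * (Real.logb 2 #(𝒜.memberSubfamily a) -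
        Real.logb 2 #{s ∈ 𝒜.memberSubfamily a | s ⊆ J}) ≤ memberFreq a 𝒜 *
          (l.map fun i => if i ∈ J then 0 else condEntropy l (𝒜.memberSubfamily a) i).sum := by
      rcases hp₀.eq_or_lt with h | h
      · simp [← h]
      · exact mul_le_mul_of_nonneg_left (h₁ h) hp₀
    by_cases haJ : a ∈ J
    -- Both families split at `a`. The chain rule for `𝒜` is an equality, and Gibbs' inequality for
    -- the restricted family, with the weights of `𝒜`, produces the same `bitEntropy` term, which
    -- cancels.
    · have hG := bitEntropy_add_le_logb_add hp₀ hp₁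
        (x := #({s ∈ 𝒜 | s ⊆ J}.nonMemberSubfamily a))
        (y := #({s ∈ 𝒜 | s ⊆ J}.memberSubfamily a)) (Nat.cast_nonneg _) (Nat.cast_nonneg _)
      have f₀ : {s ∈ 𝒜 | s ⊆ J}.nonMemberSubfamily a = {s ∈ 𝒜.nonMemberSubfamily a | s ⊆ J} := by
        ext s
        simp only [mem_nonMemberSubfamily, mem_filter]
        tauto
      have f₁ : {s ∈ 𝒜 | s ⊆ J}.memberSubfamily a = {s ∈ 𝒜.memberSubfamily a | s ⊆ J} := by
        ext s
        simp only [mem_memberSubfamily, mem_filter, insert_subset_iff]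
        tauto
      rw [← card_eq_add, f₀, f₁] at hG
      have := hG (fun _ => empty_mem h𝒜.nonMemberSubfamily hA₀)
        (fun h => empty_mem h𝒜.memberSubfamily (memberSubfamily_nonempty_of_memberFreq_pos h))
      rw [if_pos haJ]
      linarith
    -- The restricted family lies in the part avoiding `a`, which contains the other fibre, so the
    -- only new loss is the entropy of coordinate `a`.
    · have f₀ : {s ∈ 𝒜 | s ⊆ J} = {s ∈ 𝒜.nonMemberSubfamily a | s ⊆ J} := by
        ext s
        simp only [mem_nonMemberSubfamily, mem_filter]
        exact ⟨fun h => ⟨⟨h.1, fun h' => haJ (h.2 h')⟩, h.2⟩, fun h => ⟨h.1.1, h.2⟩⟩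
      have f₁ : memberFreq a 𝒜 * Real.logb 2 #{s ∈ 𝒜.memberSubfamily a | s ⊆ J} ≤
          memberFreq a 𝒜 * Real.logb 2 #{s ∈ 𝒜.nonMemberSubfamily a | s ⊆ J} := by
        rcases hp₀.eq_or_lt with h | h
        · simp [← h]
        · apply mul_le_mul_of_nonneg_left _ hp₀
          apply Real.logb_le_logb_of_le one_lt_two
          · exact empty_mem h𝒜.memberSubfamily (memberSubfamily_nonempty_of_memberFreq_pos h)
          · exact_mod_cast card_le_card (filter_subset_filter _ h𝒜.memberSubfamily_subset_nonMemberSubfamily)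
      rw [if_neg haJ, f₀]
      linarith

end SetFamily

/-! ### Choosing the coordinates of the covering subspace -/

section SetFamily

open Finset FinsetFamily

variable {α : Type*} [DecidableEq α]

/-- A trace `s \ J`, itself a member, and a member `t ⊆ J` are both recovered from their union. -/
lemma card_image_sdiff_mul_card_filter_le {𝒜 : Finset (Finset α)}
    (h𝒜 : IsLowerSet (𝒜 : Set (Finset α))) (J : Finset α) :
    #(𝒜.image (· \ J)) * #{s ∈ 𝒜 | s ⊆ J} ≤ #(𝒜 ⊻ 𝒜) := by
  rw [← card_product]
  apply card_le_card_of_injOn fun x => x.1 ⊔ x.2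
  · rintro ⟨s, t⟩ h
    simp only [coe_product, Set.mem_prod, mem_coe, mem_image, mem_filter] at h
    obtain ⟨⟨u, hu, rfl⟩, ht, -⟩ := h
    exact sup_mem_sups (h𝒜 sdiff_subset hu) ht
  · rintro ⟨s, t⟩ h ⟨s', t'⟩ h' e
    simp only [coe_product, Set.mem_prod, mem_coe, mem_image, mem_filter] at h h'
    obtain ⟨⟨u, -, rfl⟩, -, ht⟩ := h
    obtain ⟨⟨u', -, rfl⟩, -, ht'⟩ := h'
    simp only [sup_eq_union, Finset.ext_iff, mem_union, mem_sdiff] at e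
    simp only [Prod.mk.injEq, Finset.ext_iff, mem_sdiff]
    refine ⟨fun i => ?_, fun i => ?_⟩
    · have h1 := e i
      have h2 := @ht i
      have h3 := @ht' i
      tauto
    · have h1 := e i
      have h2 := @ht i
      have h3 := @ht' i
      tauto

/-- A trace outside `J` is its part outside `J'` together with a subset of `J' \ J`. -/
lemma card_image_sdiff_le {𝒜 : Finset (Finset α)} {J J' : Finset α} (h : J ⊆ J') :
    #(𝒜.image (· \ J)) ≤ #(𝒜.image (· \ J')) * 2 ^ (#J' - #J) := by
  rw [← card_sdiff_of_subset h, ← card_powerset]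
  refine (card_le_card ?_).trans (card_sups_le (𝒜.image (· \ J')) (J' \ J).powerset)
  intro u hu
  obtain ⟨s, hs, rfl⟩ := mem_image.1 hu
  refine mem_sups.2 ⟨s \ J', mem_image_of_mem _ hs, s ∩ (J' \ J),
    mem_powerset.2 inter_subset_right, ?_⟩
  ext i
  have := @h i
  simp only [sup_eq_union, mem_union, mem_sdiff, mem_inter]
  tauto

/-- A down-closed family with few unions has a set `J` of coordinates such that both the projection
to the complement of `J` is small, and the family is dense on `J`. -/
lemma exists_two_pow_card_le [Fintype α] {𝒜 : Finset (Finset α)}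
    (h𝒜 : IsLowerSet (𝒜 : Set (Finset α))) (hA : 𝒜.Nonempty) :
    ∃ J : Finset α,
      (#𝒜 : ℝ) ≤ #{s ∈ 𝒜 | s ⊆ J} * ((#(𝒜 ⊻ 𝒜) : ℝ) / #𝒜) ^ 45 ∧
      (2 : ℝ) ^ #J ≤ #{s ∈ 𝒜 | s ⊆ J} * ((#(𝒜 ⊻ 𝒜) : ℝ) / #𝒜) ^ 45 := by
  set l := (univ : Finset α).toList with hl
  have nd : l.Nodup := nodup_toList _
  have sA : ∀ s ∈ 𝒜, ∀ i ∈ s, i ∈ l := fun s _ i _ => mem_toList.2 (mem_univ i)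
  set U := condEntropy l 𝒜 with hU
  have h1 := sum_condEntropy nd sA
  have h2 := sum_gainBound_le_logb_card_sups nd h𝒜 h𝒜 hA hA sA sA
  let J : Finset α := {i | 1 / 2 < U i}
  have h3 := logb_card_sub_logb_card_filter_le nd h𝒜 hA sA J
  rw [← hU, hl, sum_map_toList] at h1 h2 h3
  -- For `u` in `[0, 1]`, `min u (1 - u) ≤ 2u(1 - u)`; this is the source of the exponent 45.
  have p1 : ∀ i, (if i ∈ J then 0 else U i) + (if i ∈ J then 1 - U i else 0) ≤
      45 * (gainBound (U i) (U i) - U i) := by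
    intro i
    obtain ⟨u₀, u₁⟩ := condEntropy_mem_Icc l 𝒜 i
    rw [← hU] at u₀ u₁
    unfold gainBound
    simp only [J, mem_filter, mem_univ, true_and]
    split_ifs with h <;> nlinarith
  have p2 : ∀ i, (if i ∈ J then 1 else 0) - U i ≤ (if i ∈ J then 1 - U i else 0) := by
    intro i
    have u₀ : 0 ≤ U i := (condEntropy_mem_Icc l 𝒜 i).1
    split_ifs <;> linarith
  have p3 : ∀ i, 0 ≤ (if i ∈ J then 1 - U i else 0) := by
    intro i
    have u₁ : U i ≤ 1 := (condEntropy_mem_Icc l 𝒜 i).2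
    split_ifs <;> linarith
  have q1 := sum_le_sum fun i (_ : i ∈ univ) => p1 i
  have q2 := sum_le_sum fun i (_ : i ∈ univ) => p2 i
  have q3 := sum_nonneg fun i (_ : i ∈ univ) => p3 i
  rw [sum_add_distrib, ← mul_sum, sum_sub_distrib] at q1
  rw [sum_sub_distrib, sum_boole, filter_mem_eq_inter, univ_inter] at q2
  have hF : (0 : ℝ) < #{s ∈ 𝒜 | s ⊆ J} := by
    obtain ⟨s, hs⟩ := hA
    exact_mod_cast card_pos.2 ⟨∅, mem_filter.2 ⟨h𝒜 (empty_subset s) hs, empty_subset J⟩⟩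
  have hA' : (0 : ℝ) < #𝒜 := by exact_mod_cast hA.card_pos
  have hS : (0 : ℝ) < #(𝒜 ⊻ 𝒜) := by exact_mod_cast (hA.sups hA).card_pos
  have hlog : Real.logb 2 (#{s ∈ 𝒜 | s ⊆ J} * ((#(𝒜 ⊻ 𝒜) : ℝ) / #𝒜) ^ 45) =
      Real.logb 2 #{s ∈ 𝒜 | s ⊆ J} + 45 * (Real.logb 2 #(𝒜 ⊻ 𝒜) - Real.logb 2 #𝒜) := by
    rw [Real.logb_mul hF.ne' (by positivity), Real.logb_pow, Real.logb_div hS.ne' hA'.ne']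
    norm_num
  refine ⟨J, ?_, ?_⟩
  · rw [← Real.logb_le_logb one_lt_two hA' (by positivity), hlog]
    linarith
  · rw [← Real.logb_le_logb one_lt_two (by positivity) (by positivity), hlog, logb_two_pow]
    linarith

theorem exists_two_pow_card_le_and_card_image_sdiff_le [Fintype α] {𝒜 : Finset (Finset α)}
    (h𝒜 : IsLowerSet (𝒜 : Set (Finset α))) (hA : 𝒜.Nonempty) :
    ∃ J : Finset α, 2 ^ #J ≤ #𝒜 ∧
      (#(𝒜.image (· \ J)) : ℝ) ≤ 2 * ((#(𝒜 ⊻ 𝒜) : ℝ) / #𝒜) ^ 46 := by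
  obtain ⟨J, h1, h2⟩ := exists_two_pow_card_le h𝒜 hA
  have hF : (0 : ℝ) < #{s ∈ 𝒜 | s ⊆ J} := by
    obtain ⟨s, hs⟩ := hA
    exact_mod_cast card_pos.2 ⟨∅, mem_filter.2 ⟨h𝒜 (empty_subset s) hs, empty_subset J⟩⟩
  have hA' : (0 : ℝ) < #𝒜 := by exact_mod_cast hA.card_pos
  have hS : (0 : ℝ) < #(𝒜 ⊻ 𝒜) := by exact_mod_cast (hA.sups hA).card_pos
  have h3 : (#(𝒜.image (· \ J)) : ℝ) * #{s ∈ 𝒜 | s ⊆ J} ≤ #(𝒜 ⊻ 𝒜) := by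
    exact_mod_cast card_image_sdiff_mul_card_filter_le h𝒜 J
  set K : ℝ := (#(𝒜 ⊻ 𝒜) : ℝ) / #𝒜 with hK
  have hK₀ : 0 < K := by positivity
  have h4 : (#(𝒜 ⊻ 𝒜) : ℝ) = K * #𝒜 := by
    rw [hK]
    field_simp
  rw [h4] at h3
  rcases le_or_gt (2 ^ #J) #𝒜 with hJ | hJ
  · refine ⟨J, hJ, ?_⟩
    have : (#(𝒜.image (· \ J)) : ℝ) * #{s ∈ 𝒜 | s ⊆ J} ≤ K ^ 46 * #{s ∈ 𝒜 | s ⊆ J} := by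
      have := mul_le_mul_of_nonneg_left h1 hK₀.le
      have e : K * (#{s ∈ 𝒜 | s ⊆ J} * K ^ 45) = K ^ 46 * #{s ∈ 𝒜 | s ⊆ J} := by ring
      linarith
    have := le_of_mul_le_mul_right this hF
    have : 0 < K ^ 46 := pow_pos hK₀ 46
    linarith
  -- When `2^|J|` is too large, `J` is trimmed to `Nat.log 2 #𝒜` elements. The growth of the trace
  -- count is paid for by `h2`; rounding the logarithm down costs the factor 2.
  · have hlog : Nat.log 2 #𝒜 ≤ #J := (Nat.log_lt_of_lt_pow hA.card_pos.ne' hJ).le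
    obtain ⟨J', hJ', hc⟩ := exists_subset_card_eq hlog
    refine ⟨J', hc ▸ Nat.pow_log_le_self 2 hA.card_pos.ne', ?_⟩
    have h5 : (#(𝒜.image (· \ J')) : ℝ) ≤ #(𝒜.image (· \ J)) * 2 ^ (#J - #J') := by
      exact_mod_cast card_image_sdiff_le hJ'
    have h6 : (#𝒜 : ℝ) ≤ 2 * 2 ^ #J' := by
      have := (Nat.lt_pow_succ_log_self one_lt_two #𝒜).le
      rw [← hc, pow_succ, mul_comm] at this
      exact_mod_cast this
    have h7 : (2 : ℝ) ^ (#J - #J') * 2 ^ #J' = 2 ^ #J := by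
      rw [← pow_add, Nat.sub_add_cancel (card_le_card hJ')]
    set X : ℝ := (2 : ℝ) ^ (#J - #J') with hX
    have hX₀ : 0 < X := by positivity
    set F : ℝ := ((#{s ∈ 𝒜 | s ⊆ J} : ℕ) : ℝ)
    have h8 : X * #𝒜 ≤ 2 * (F * K ^ 45) := by
      have := mul_le_mul_of_nonneg_left h6 hX₀.le
      linarith
    have h9 : (#(𝒜.image (· \ J)) : ℝ) * X * F ≤ 2 * K ^ 46 * F := by
      calc (#(𝒜.image (· \ J)) : ℝ) * X * F = (#(𝒜.image (· \ J)) : ℝ) * F * X := by ring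
        _ ≤ K * #𝒜 * X := mul_le_mul_of_nonneg_right h3 hX₀.le
        _ = K * (X * #𝒜) := by ring
        _ ≤ K * (2 * (F * K ^ 45)) := mul_le_mul_of_nonneg_left h8 hK₀.le
        _ = 2 * K ^ 46 * F := by ring
    exact h5.trans (le_of_mul_le_mul_right h9 hF)

end SetFamily

/-! ### From set families to downsets of vectors -/

section F2Space

open Finset FinsetFamily

variable {I : Finset ℕ+}

/-- The identification of a vector over `𝔽₂` with its support. -/
def suppEquiv (I : Finset ℕ+) : F2Space I ≃ Finset I where
  toFun x := {i | x i = 1}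
  invFun s i := if i ∈ s then 1 else 0
  left_inv x := by
    funext i
    rcases (by decide : ∀ z : ZMod 2, z = 0 ∨ z = 1) (x i) with h | h <;> simp [h]
  right_inv s := by
    ext i
    simp

lemma mem_suppEquiv {x : F2Space I} {i : I} : i ∈ suppEquiv I x ↔ x i = 1 := by
  simp [suppEquiv]

lemma suppEquiv_symm_apply (s : Finset I) (i : I) :
    (suppEquiv I).symm s i = if i ∈ s then 1 else 0 := rfl

/-- The definition of a downset clears one coordinate at a time; induction on the set of removed
coordinates gives all subsets. -/
lemma IsDownset.isLowerSet {A : Finset (F2Space I)} (h : IsDownset A) :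
    IsLowerSet (A.map (suppEquiv I).toEmbedding : Set (Finset I)) := by
  have key : ∀ s t : Finset I, (suppEquiv I).symm (t ∪ s) ∈ A → Disjoint t s →
      (suppEquiv I).symm t ∈ A := by
    intro s
    induction s using Finset.induction_on with
    | empty => simp
    | insert a s ha ih =>
      intro t hA hd
      rw [disjoint_insert_right] at hd
      apply ih t _ hd.2
      apply h a
      · simp [suppEquiv_symm_apply, hd.1, ha]
      · convert hA using 1
        funext i
        by_cases hi : i = a
        · subst hi
          simp [suppEquiv_symm_apply, hd.1, ha]
        · simp [suppEquiv_symm_apply, hi]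
  intro s t hts hs
  simp only [coe_map, Equiv.coe_toEmbedding, Set.mem_image, mem_coe] at hs ⊢
  obtain ⟨x, hx, rfl⟩ := hs
  refine ⟨(suppEquiv I).symm t, key (suppEquiv I x \ t) t ?_ disjoint_sdiff, by simp⟩
  rw [union_sdiff_of_subset hts]
  simpa using hx

/-- A union `s ∪ t` is the vector sum of `s` and `t \ s`, and `t \ s` stays in the downset. -/
lemma card_sups_le_card_add {A : Finset (F2Space I)} (h : IsDownset A) :
    #(A.map (suppEquiv I).toEmbedding ⊻ A.map (suppEquiv I).toEmbedding) ≤ #(A + A) := by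
  rw [← card_map (suppEquiv I).toEmbedding (s := A + A)]
  apply card_le_card
  intro u hu
  obtain ⟨s, hs, t, ht, rfl⟩ := mem_sups.1 hu
  have ht' := h.isLowerSet (sdiff_subset : t \ s ⊆ t) ht
  simp only [coe_map, Equiv.coe_toEmbedding, Set.mem_image, mem_coe, mem_map] at hs ht' ⊢
  obtain ⟨x, hx, rfl⟩ := hs
  obtain ⟨z, hz, hz'⟩ := ht'
  refine ⟨x + z, add_mem_add hx hz, ?_⟩
  ext i
  have e : z i = 1 ↔ i ∈ t ∧ x i ≠ 1 := by
    rw [← mem_suppEquiv, hz', mem_sdiff, mem_suppEquiv]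
  simp only [mem_suppEquiv, Pi.add_apply, sup_eq_union, mem_union]
  rcases (by decide : ∀ z : ZMod 2, z = 0 ∨ z = 1) (x i) with h | h <;>
    rcases (by decide : ∀ z : ZMod 2, z = 0 ∨ z = 1) (z i) with h' | h' <;>
    simp [h, h'] at e ⊢ <;> tauto

/-- The subspace of vectors supported on `J`. -/
def coordSubspace (J : Finset I) : Submodule (ZMod 2) (F2Space I) where
  carrier := {x | ∀ i ∉ J, x i = 0}
  add_mem' := by
    intro x y hx hy i hi
    simp [hx i hi, hy i hi]
  zero_mem' := by simp
  smul_mem' := by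
    intro c x hx i hi
    simp [hx i hi]

lemma card_coordSubspace_le (J : Finset I) : Nat.card (coordSubspace J) ≤ 2 ^ #J := by
  have h : Function.Injective fun (x : coordSubspace J) (i : J) => x.1 i.1 := by
    intro x y e
    ext i
    by_cases hi : i ∈ J
    · exact congrFun e ⟨i, hi⟩
    · rw [x.2 i hi, y.2 i hi]
  simpa using Nat.card_le_card_of_injective _ h

/-- A downset is covered by polynomially many translates of a coordinate subspace. -/
theorem coveredByTranslates_of_isDownset {A : Finset (F2Space I)} (hne : A.Nonempty)
    (h : IsDownset A) : CoveredByTranslates A (2 * doublingConst A ^ 46) := by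
  obtain ⟨J, hJ, hT⟩ := exists_two_pow_card_le_and_card_image_sdiff_le h.isLowerSet
    (hne.map (f := (suppEquiv I).toEmbedding))
  rw [card_map] at hJ hT
  refine ⟨coordSubspace J, (card_coordSubspace_le J).trans hJ,
    ((A.map (suppEquiv I).toEmbedding).image (· \ J)).map (suppEquiv I).symm.toEmbedding, ?_, ?_⟩
  · rw [card_map]
    refine hT.trans ?_
    unfold doublingConst
    have : ((#(A.map (suppEquiv I).toEmbedding ⊻ A.map (suppEquiv I).toEmbedding) : ℕ) : ℝ) ≤
        (#(A + A) : ℕ) := by exact_mod_cast card_sups_le_card_add h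
    gcongr
  · intro x hx
    simp only [Set.mem_iUnion, exists_prop]
    -- A vector differs from its restriction to the complement of `J` by a vector supported on `J`.
    refine ⟨(suppEquiv I).symm (suppEquiv I x \ J), ?_, ?_⟩
    · exact mem_map_of_mem _ (mem_image_of_mem _ (mem_map_of_mem _ hx))
    · rw [Set.mem_vadd_set_iff_neg_vadd_mem]
      intro i hi
      rcases (by decide : ∀ z : ZMod 2, z = 0 ∨ z = 1) (x i) with h | h
      · simp [suppEquiv_symm_apply, hi, h, mem_suppEquiv]
      · simp only [suppEquiv_symm_apply, mem_sdiff, mem_suppEquiv, h, hi, vadd_eq_add,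
          Pi.add_apply, Pi.neg_apply, not_false_eq_true, and_self, if_true, neg_add_cancel]

end F2Space

/-! ### Lower bounds for covering numbers -/

section Transversal

open Finset

variable {I : Finset ℕ+}

/-- Every subspace has a complement spanned by standard basis vectors. -/
lemma exists_coordSubspace_disjoint (V : Submodule (ZMod 2) (F2Space I)) :
    ∃ T : Finset I, #I ≤ #T + Module.finrank (ZMod 2) V ∧
      ∀ x ∈ coordSubspace T, x ∈ V → x = 0 := by
  classical
  let v : I → F2Space I ⧸ V := fun i => V.mkQ (Pi.single i 1)
  -- The images of the standard basis span the quotient by `V`, so some of them form a basis `b`.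
  -- Spanning bounds `#b` from below; independence makes the coordinate subspace meet `V` trivially.
  obtain ⟨b, -, -, hspan, hb⟩ := exists_linearIndepOn_extension (K := ZMod 2) (v := v)
    (linearIndepOn_empty (ZMod 2) v) (Set.empty_subset Set.univ)
  have mkQ_eq : ∀ x : F2Space I, V.mkQ x = ∑ i, x i • v i := by
    intro x
    conv_lhs => rw [pi_eq_sum_univ' x]
    simp [v, map_sum]
  refine ⟨b.toFinset, ?_, ?_⟩
  · have htop : Submodule.span (ZMod 2) (v '' b) = ⊤ := by
      rw [eq_top_iff]
      rintro y -
      obtain ⟨x, rfl⟩ := V.mkQ_surjective y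
      rw [mkQ_eq]
      exact Submodule.sum_mem _ fun i _ => Submodule.smul_mem _ _
        (hspan (Set.mem_image_of_mem v (Set.mem_univ i)))
    have h1 : Module.finrank (ZMod 2) (F2Space I ⧸ V) ≤ #b.toFinset := by
      rw [← finrank_top, ← htop]
      refine (finrank_span_le_card _).trans ?_
      rw [Set.toFinset_image]
      exact card_image_le
    have h2 := V.finrank_quotient_add_finrank
    rw [Module.finrank_fintype_fun_eq_card, Fintype.card_coe] at h2
    omega
  · intro x hx hxV
    rw [← Set.coe_toFinset b, linearIndepOn_finset_iff] at hb
    have h0 : ∑ i ∈ b.toFinset, x i • v i = 0 := by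
      rw [← (Submodule.Quotient.mk_eq_zero V).2 hxV, ← Submodule.mkQ_apply, mkQ_eq]
      apply sum_subset (subset_univ _)
      intro i _ hi
      rw [hx i hi, zero_smul]
    funext i
    by_cases hi : i ∈ b.toFinset
    · exact hb x h0 i hi
    · exact hx i hi

/-- A covering of `A` by translates of a subspace needs at least as many translates as `A` has
points in a suitable coordinate subspace of complementary dimension. -/
lemma CoveredByTranslates.exists_card_le {A : Finset (F2Space I)} {C : ℝ}
    (h : CoveredByTranslates A C) {d : ℕ} (hd : #A ≤ 2 ^ d) :
    ∃ T : Finset I, #I ≤ #T + d ∧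
      ∀ B : Finset (F2Space I), B ⊆ A → (∀ x ∈ B, x ∈ coordSubspace T) → (#B : ℝ) ≤ C := by
  classical
  obtain ⟨V, hV, S, hS, hcov⟩ := h
  obtain ⟨T, hT, hinj⟩ := exists_coordSubspace_disjoint V
  refine ⟨T, hT.trans ?_, ?_⟩
  · have : Nat.card V = 2 ^ Module.finrank (ZMod 2) V := by
      rw [Module.natCard_eq_pow_finrank (K := ZMod 2), Nat.card_zmod]
    rw [this] at hV
    have := (Nat.pow_le_pow_iff_right one_lt_two).1 (hV.trans hd)
    omega
  · intro B hBA hBT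
    refine le_trans ?_ hS
    have hc : ∀ x ∈ B, ∃ t ∈ S, x - t ∈ V := by
      intro x hx
      have := hcov (hBA hx)
      simp only [Set.mem_iUnion, exists_prop, Set.mem_vadd_set_iff_neg_vadd_mem] at this
      obtain ⟨t, ht, hx⟩ := this
      refine ⟨t, ht, ?_⟩
      rw [sub_eq_neg_add]
      exact hx
    choose! f hfS hfV using hc
    -- Two points of `B` in one translate differ by an element of `V` and of the coordinate
    -- subspace, hence coincide.
    have : #B ≤ #S := by
      apply card_le_card_of_injOn f hfS
      intro x hx y hy e
      have h1 := V.sub_mem (hfV x hx) (hfV y hy)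
      rw [e, sub_sub_sub_cancel_right] at h1
      exact sub_eq_zero.1 (hinj _ ((coordSubspace T).sub_mem (hBT x hx) (hBT y hy)) h1)
    exact_mod_cast this

end Transversal

/-! ### Volumes of Hamming balls -/

section HammingBall

open Finset

variable {I : Finset ℕ+}

/-- The Hamming ball of radius `r` around the origin. -/
noncomputable def originBall (I : Finset ℕ+) (r : ℕ) : Finset (F2Space I) :=
  {x | #(suppEquiv I x) ≤ r}

lemma mem_originBall {r : ℕ} {x : F2Space I} : x ∈ originBall I r ↔ #(suppEquiv I x) ≤ r := by
  simp [originBall]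

lemma isDownset_originBall (r : ℕ) : IsDownset (originBall I r) := by
  intro i x hx h
  rw [mem_originBall] at h ⊢
  refine (card_le_card ?_).trans h
  intro j hj
  rw [mem_suppEquiv] at hj ⊢
  have : j ≠ i := by
    rintro rfl
    rw [hx] at hj
    exact zero_ne_one hj
  simp [this, hj]

lemma originBall_add_subset (r : ℕ) : originBall I r + originBall I r ⊆ originBall I (2 * r) := by
  intro z hz
  obtain ⟨x, hx, y, hy, rfl⟩ := mem_add.1 hz
  rw [mem_originBall] at hx hy ⊢
  have : suppEquiv I (x + y) ⊆ suppEquiv I x ∪ suppEquiv I y := by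
    intro i hi
    rw [mem_union]
    rw [mem_suppEquiv, Pi.add_apply] at hi
    rw [mem_suppEquiv, mem_suppEquiv]
    revert hi
    generalize x i = a
    generalize y i = b
    revert a b
    decide
  have h1 := (card_le_card this).trans (card_union_le _ _)
  omega

/-- The vectors of weight exactly `r` supported on `T`. With `T` everything they bound the ball from
below; with `T` transversal to a subspace they bound its covering number. -/
lemma choose_le_card_originBall (T : Finset I) (r : ℕ) :
    ∃ B : Finset (F2Space I), B ⊆ originBall I r ∧ (∀ x ∈ B, x ∈ coordSubspace T) ∧
      #B = (#T).choose r := by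
  refine ⟨(T.powersetCard r).map (suppEquiv I).symm.toEmbedding, ?_, ?_, ?_⟩
  · intro x hx
    obtain ⟨s, hs, rfl⟩ := mem_map.1 hx
    rw [mem_originBall]
    simp [(mem_powersetCard.1 hs).2]
  · intro x hx i hi
    obtain ⟨s, hs, rfl⟩ := mem_map.1 hx
    have : i ∉ s := fun h => hi ((mem_powersetCard.1 hs).1 h)
    simp [suppEquiv_symm_apply, this]
  · rw [card_map, card_powersetCard]

/-- The entropy bound for the volume of Hamming balls. -/
lemma card_originBall_mul_le {r m : ℕ} (hI : #I = r + m) (hr : r ≤ m) :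
    #(originBall I r) * (r ^ r * m ^ m) ≤ (r + m) ^ (r + m) := by
  -- Expand `(r + m)^(r + m)` over subsets: a subset of size `j ≤ r` contributes `r^j m^(r + m -
  -- j)`, at least `r^r m^m` because `r ≤ m`.
  have h := sum_pow_mul_eq_add_pow r m (univ : Finset I)
  rw [card_univ, Fintype.card_coe, hI] at h
  rw [← h, ← smul_eq_mul, ← card_map (suppEquiv I).toEmbedding, ← sum_const]
  refine le_trans (sum_le_sum ?_) (sum_le_sum_of_subset (subset_univ _))
  intro s hs
  obtain ⟨x, hx, rfl⟩ := mem_map.1 hs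
  rw [mem_originBall] at hx
  simp only [Equiv.coe_toEmbedding]
  set j := #(suppEquiv I x)
  obtain ⟨d, hd⟩ := Nat.exists_eq_add_of_le hx
  have e : r + m - j = d + m := by omega
  rw [e]
  calc r ^ r * m ^ m = r ^ j * r ^ d * m ^ m := by
        rw [← pow_add, ← hd]
    _ ≤ r ^ j * m ^ d * m ^ m := by gcongr
    _ = r ^ j * m ^ (d + m) := by ring

end HammingBall

/-! ### Stirling bounds for binomial coefficients -/

section Binomial

open Nat Real

/-- The Stirling sequence is antitone, so it is at most its value `e / √2` at 1. -/
lemma factorial_le_mul_div_exp_pow {n : ℕ} (hn : n ≠ 0) :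
    (n ! : ℝ) ≤ 3 * n * (n / exp 1) ^ n := by
  obtain ⟨m, rfl⟩ := Nat.exists_eq_succ_of_ne_zero hn
  have h := Stirling.stirlingSeq'_antitone (Nat.zero_le m)
  simp only [Function.comp_apply, Nat.succ_eq_add_one, zero_add, Stirling.stirlingSeq_one] at h
  rw [Stirling.stirlingSeq, div_le_div_iff₀ (by positivity) (by positivity)] at h
  have h2 : √(2 * ((m + 1 : ℕ) : ℝ)) = √2 * √((m + 1 : ℕ) : ℝ) := Real.sqrt_mul (by norm_num) _
  have h3 : √((m + 1 : ℕ) : ℝ) ≤ ((m + 1 : ℕ) : ℝ) := by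
    rw [Real.sqrt_le_left (by positivity)]
    have : (1 : ℝ) ≤ ((m + 1 : ℕ) : ℝ) := by exact_mod_cast Nat.succ_le_succ (Nat.zero_le m)
    nlinarith
  have h4 := Real.exp_one_lt_d9
  rw [h2] at h
  have hs : (0 : ℝ) < √2 := by positivity
  set P : ℝ := (((m + 1 : ℕ) : ℝ) / exp 1) ^ (m + 1)
  have hP : 0 ≤ P := by positivity
  have h5 : exp 1 * √((m + 1 : ℕ) : ℝ) ≤ 3 * ((m + 1 : ℕ) : ℝ) :=
    mul_le_mul (by linarith) h3 (by positivity) (by norm_num)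
  have h6 := mul_le_mul_of_nonneg_right h5 hP
  have h7 : ((m + 1)! : ℝ) * √2 ≤ (3 * ((m + 1 : ℕ) : ℝ) * P) * √2 := by
    calc ((m + 1)! : ℝ) * √2 ≤ exp 1 * (√2 * √((m + 1 : ℕ) : ℝ) * P) := h
      _ = exp 1 * √((m + 1 : ℕ) : ℝ) * P * √2 := by ring
      _ ≤ (3 * ((m + 1 : ℕ) : ℝ) * P) * √2 := mul_le_mul_of_nonneg_right h6 hs.le
  exact le_of_mul_le_mul_right h7 hs

lemma div_exp_pow_le_factorial {n : ℕ} (hn : n ≠ 0) : ((n : ℝ) / exp 1) ^ n ≤ n ! := by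
  refine le_trans ?_ (Stirling.le_factorial_stirling n)
  apply le_mul_of_one_le_left (by positivity)
  rw [Real.one_le_sqrt]
  have h1 : (1 : ℝ) ≤ n := by exact_mod_cast Nat.one_le_iff_ne_zero.2 hn
  have h2 := Real.pi_gt_three
  nlinarith

/-- The entropy lower bound for binomial coefficients. -/
lemma add_pow_le_choose_mul {r m : ℕ} (hr : r ≠ 0) (hm : m ≠ 0) :
    ((r + m : ℕ) : ℝ) ^ (r + m) ≤
      9 * ((r + m : ℕ) : ℝ) ^ 2 * ((r + m).choose r : ℝ) * ((r : ℝ) ^ r * (m : ℝ) ^ m) := by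
  have h1 := div_exp_pow_le_factorial (n := r + m) (by omega)
  have h2 := factorial_le_mul_div_exp_pow hr
  have h3 := factorial_le_mul_div_exp_pow hm
  have h4 : ((r + m).choose r : ℝ) * r ! * m ! = (r + m)! := by
    have := Nat.choose_mul_factorial_mul_factorial (Nat.le_add_right r m)
    rw [Nat.add_sub_cancel_left] at this
    exact_mod_cast this
  rw [← h4] at h1
  rw [div_pow] at h1 h2 h3
  have hE : (0 : ℝ) < exp 1 ^ (r + m) := by positivity
  have h5 : ((r + m).choose r : ℝ) * r ! * m ! ≤ ((r + m).choose r : ℝ) *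
      (3 * r * ((r : ℝ) ^ r / exp 1 ^ r)) * (3 * m * ((m : ℝ) ^ m / exp 1 ^ m)) := by
    gcongr
  have h6 := h1.trans h5
  have e : ((r + m).choose r : ℝ) * (3 * r * ((r : ℝ) ^ r / exp 1 ^ r)) *
      (3 * m * ((m : ℝ) ^ m / exp 1 ^ m)) =
      9 * (r * m) * ((r + m).choose r : ℝ) * ((r : ℝ) ^ r * (m : ℝ) ^ m) / exp 1 ^ (r + m) := by
    rw [pow_add]
    field_simp
    ring
  rw [e, div_le_div_iff_of_pos_right hE] at h6
  refine h6.trans ?_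
  have : (r : ℝ) * m ≤ ((r + m : ℕ) : ℝ) ^ 2 := by
    push_cast
    nlinarith [(Nat.cast_nonneg r : (0 : ℝ) ≤ r), (Nat.cast_nonneg m : (0 : ℝ) ≤ m)]
  gcongr

end Binomial

/-! ### Exponential rates and their numerical values -/

section Asymptotics

open Finset

/-- The exponential growth rate, in bits, of the binomial coefficients
`((x + y) * k).choose (x * k)`. -/
noncomputable def chooseRate (x y : ℝ) : ℝ :=
  (x + y) * Real.logb 2 (x + y) - x * Real.logb 2 x - y * Real.logb 2 y

lemma chooseRate_mul {x y k : ℝ} (hx : 0 < x) (hy : 0 < y) (hk : 0 < k) :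
    chooseRate (x * k) (y * k) = k * chooseRate x y := by
  unfold chooseRate
  rw [← add_mul, Real.logb_mul (by positivity) hk.ne', Real.logb_mul hx.ne' hk.ne',
    Real.logb_mul hy.ne' hk.ne']
  ring

lemma logb_add_pow_div {r m : ℕ} (hr : r ≠ 0) (hm : m ≠ 0) :
    Real.logb 2 (((r + m : ℕ) : ℝ) ^ (r + m) / ((r : ℝ) ^ r * (m : ℝ) ^ m)) =
      chooseRate r m := by
  have hr' : (r : ℝ) ≠ 0 := by exact_mod_cast hr
  have hm' : (m : ℝ) ≠ 0 := by exact_mod_cast hm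
  have hrm : ((r + m : ℕ) : ℝ) ≠ 0 := by
    exact_mod_cast fun h => hr (Nat.add_eq_zero_iff.1 h).1
  rw [Real.logb_div (pow_ne_zero _ hrm) (mul_ne_zero (pow_ne_zero _ hr') (pow_ne_zero _ hm')),
    Real.logb_mul (pow_ne_zero _ hr') (pow_ne_zero _ hm'), Real.logb_pow, Real.logb_pow,
    Real.logb_pow, chooseRate]
  push_cast
  ring

lemma originBall_nonempty (I : Finset ℕ+) (r : ℕ) : (originBall I r).Nonempty :=
  ⟨(suppEquiv I).symm ∅, by simp [mem_originBall]⟩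

lemma logb_card_originBall_le {I : Finset ℕ+} {r m : ℕ} (hI : #I = r + m) (hr : r ≤ m)
    (hr₀ : r ≠ 0) : Real.logb 2 #(originBall I r) ≤ chooseRate r m := by
  have hm : m ≠ 0 := by omega
  have h : (#(originBall I r) : ℝ) * ((r : ℝ) ^ r * (m : ℝ) ^ m) ≤
      ((r + m : ℕ) : ℝ) ^ (r + m) := by exact_mod_cast card_originBall_mul_le hI hr
  have hr' : (0 : ℝ) < r := by exact_mod_cast Nat.pos_of_ne_zero hr₀
  have hm' : (0 : ℝ) < m := by exact_mod_cast Nat.pos_of_ne_zero hm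
  rw [← logb_add_pow_div hr₀ hm]
  apply Real.logb_le_logb_of_le one_lt_two
  · exact_mod_cast (originBall_nonempty I r).card_pos
  · rwa [le_div_iff₀ (by positivity)]

lemma chooseRate_sub_le_logb_choose {r m : ℕ} (hr : r ≠ 0) (hm : m ≠ 0) :
    chooseRate r m - Real.logb 2 (9 * ((r + m : ℕ) : ℝ) ^ 2) ≤
      Real.logb 2 ((r + m).choose r) := by
  have h := add_pow_le_choose_mul hr hm
  have hr' : (0 : ℝ) < r := by exact_mod_cast Nat.pos_of_ne_zero hr
  have hm' : (0 : ℝ) < m := by exact_mod_cast Nat.pos_of_ne_zero hm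
  have hc : (0 : ℝ) < (r + m).choose r := by
    exact_mod_cast Nat.choose_pos (Nat.le_add_right r m)
  have hrm : (0 : ℝ) < (r + m : ℕ) := by
    push_cast
    positivity
  rw [sub_le_iff_le_add, ← logb_add_pow_div hr hm, ← Real.logb_mul hc.ne' (by positivity)]
  apply Real.logb_le_logb_of_le one_lt_two (by positivity)
  rw [div_le_iff₀ (by positivity)]
  linarith

lemma chooseRate_119_1145_le : chooseRate 119 1145 ≤ 569 := by
  have h : 1264 ^ 1264 ≤ 2 ^ 569 * (119 ^ 119 * 1145 ^ 1145) := by decide +kernel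
  have h' : ((1264 : ℝ)) ^ 1264 ≤ 2 ^ 569 * (119 ^ 119 * 1145 ^ 1145) := by exact_mod_cast h
  have hl := Real.logb_le_logb_of_le one_lt_two (by positivity) h'
  rw [Real.logb_mul (by positivity) (by positivity), Real.logb_mul (by positivity) (by positivity),
    logb_two_pow, Real.logb_pow, Real.logb_pow, Real.logb_pow] at hl
  push_cast at hl
  unfold chooseRate
  rw [show (119 + 1145 : ℝ) = 1264 by norm_num]
  linarith

/-- This bounds the doubling rate. A rational bound turns the estimate, after clearing denominators
and exponentiating, into an inequality of natural numbers that can be evaluated. -/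
lemma chooseRate_238_1026_sub_le :
    chooseRate 238 1026 - chooseRate 119 1145 ≤ 77968 / 249 := by
  have h : (119 ^ 119 * 1145 ^ 1145) ^ 249 ≤ 2 ^ 77968 * (238 ^ 238 * 1026 ^ 1026) ^ 249 := by
    decide +kernel
  have h' : ((119 : ℝ) ^ 119 * 1145 ^ 1145) ^ 249 ≤
      2 ^ 77968 * (238 ^ 238 * 1026 ^ 1026) ^ 249 := by exact_mod_cast h
  have hl := Real.logb_le_logb_of_le one_lt_two (by positivity) h'
  rw [Real.logb_mul (by positivity) (by positivity), logb_two_pow, Real.logb_pow, Real.logb_pow,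
    Real.logb_mul (by positivity) (by positivity), Real.logb_mul (by positivity) (by positivity),
    Real.logb_pow, Real.logb_pow, Real.logb_pow, Real.logb_pow] at hl
  push_cast at hl
  unfold chooseRate
  rw [show (119 + 1145 : ℝ) = 1264 by norm_num, show (238 + 1026 : ℝ) = 1264 by norm_num]
  linarith

lemma le_chooseRate_119_576 : 41773 / 91 ≤ chooseRate 119 576 := by
  have h : 2 ^ 41773 * (119 ^ 119 * 576 ^ 576) ^ 91 ≤ (695 ^ 695) ^ 91 := by
    decide +kernel
  have h' : (2 : ℝ) ^ 41773 * (119 ^ 119 * 576 ^ 576) ^ 91 ≤ (695 ^ 695) ^ 91 := by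
    exact_mod_cast h
  have hl := Real.logb_le_logb_of_le one_lt_two (by positivity) h'
  rw [Real.logb_mul (by positivity) (by positivity), logb_two_pow, Real.logb_pow, Real.logb_pow,
    Real.logb_mul (by positivity) (by positivity),
    Real.logb_pow, Real.logb_pow, Real.logb_pow] at hl
  push_cast at hl
  unfold chooseRate
  rw [show (119 + 576 : ℝ) = 695 by norm_num]
  linarith

end Asymptotics

/-! ### Hamming balls with large covering number -/

section Examples

open Finset

/-- Hamming balls of relative radius `119 / 1264` have small doubling but large covering number. -/
lemma exists_originBall_bounds {k : ℕ} (hk : k ≠ 0) :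
    ∃ (I : Finset ℕ+) (A : Finset (F2Space I)), A.Nonempty ∧ IsDownset A ∧
      Real.logb 2 (doublingConst A) ≤
        k * (77968 / 249) + Real.logb 2 (9 * (1264 * k : ℝ) ^ 2) ∧
      ∀ C, CoveredByTranslates A C → 0 < C ∧
        k * (41773 / 91) - Real.logb 2 (9 * (1264 * k : ℝ) ^ 2) ≤ Real.logb 2 C := by
  have hk' : (0 : ℝ) < k := by exact_mod_cast Nat.pos_of_ne_zero hk
  obtain ⟨I, -, hI⟩ := Set.infinite_univ.exists_subset_card_eq (α := ℕ+) (119 * k + 1145 * k)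
  have hne := originBall_nonempty I (119 * k)
  have hA := logb_card_originBall_le hI (by omega) (by omega)
  have hAA := logb_card_originBall_le (I := I) (r := 238 * k) (m := 1026 * k) (by omega) (by omega)
    (by omega)
  have hch := chooseRate_sub_le_logb_choose (r := 119 * k) (m := 1145 * k) (by omega) (by omega)
  have hch' := chooseRate_sub_le_logb_choose (r := 119 * k) (m := 576 * k) (by omega) (by omega)
  push_cast at hA hAA hch hch'
  rw [chooseRate_mul (by norm_num) (by norm_num) hk'] at hA hAA hch hch'
  rw [← add_mul] at hch hch'
  norm_num only at hch hch'
  have n1 := chooseRate_119_1145_le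
  have n2 := chooseRate_238_1026_sub_le
  have n3 := le_chooseRate_119_576
  refine ⟨I, originBall I (119 * k), hne, isDownset_originBall _, ?_, ?_⟩
  · have hpos : (0 : ℝ) < #(originBall I (119 * k)) := by exact_mod_cast hne.card_pos
    have hpos' : (0 : ℝ) < #(originBall I (119 * k) + originBall I (119 * k)) := by
      exact_mod_cast (hne.add hne).card_pos
    rw [doublingConst, Real.logb_div hpos'.ne' hpos.ne']
    have h1 : Real.logb 2 #(originBall I (119 * k) + originBall I (119 * k)) ≤
        Real.logb 2 #(originBall I (238 * k)) := by
      apply Real.logb_le_logb_of_le one_lt_two hpos'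
      have := card_le_card (originBall_add_subset (I := I) (119 * k))
      rw [← mul_assoc] at this
      exact_mod_cast this
    have h2 : Real.logb 2 ((119 * k + 1145 * k).choose (119 * k) : ℕ) ≤
        Real.logb 2 #(originBall I (119 * k)) := by
      obtain ⟨B, hB, -, hc⟩ := choose_le_card_originBall (univ : Finset I) (119 * k)
      rw [card_univ, Fintype.card_coe, hI] at hc
      rw [← hc]
      apply Real.logb_le_logb_of_le one_lt_two
      · rw [hc]
        exact_mod_cast Nat.choose_pos (Nat.le_add_right _ _)
      · exact_mod_cast card_le_card hB
    have := mul_le_mul_of_nonneg_left n2 hk'.le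
    linarith
  · intro C hC
    -- The bound `569k` on the dimension of `V` leaves `1264k - 569k = 119k + 576k` transversal
    -- coordinates.
    have hd : #(originBall I (119 * k)) ≤ 2 ^ (569 * k) := by
      have h := hA.trans (mul_le_mul_of_nonneg_left n1 hk'.le)
      have e : (k : ℝ) * 569 = Real.logb 2 (2 ^ (569 * k)) := by
        rw [logb_two_pow]
        push_cast
        ring
      rw [e, Real.logb_le_logb one_lt_two (by exact_mod_cast hne.card_pos) (by positivity)] at h
      exact_mod_cast h
    obtain ⟨T, hT, hcov⟩ := hC.exists_card_le hd
    obtain ⟨B, hB, hBT, hc⟩ := choose_le_card_originBall T (119 * k)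
    have h1 := hcov B hB hBT
    have h2 : (119 * k + 576 * k).choose (119 * k) ≤ #B := by
      rw [hc]
      exact Nat.choose_le_choose _ (by omega)
    have h3 : ((119 * k + 576 * k).choose (119 * k) : ℝ) ≤ C :=
      le_trans (by exact_mod_cast h2) h1
    have h4 : (0 : ℝ) < (119 * k + 576 * k).choose (119 * k) := by
      exact_mod_cast Nat.choose_pos (Nat.le_add_right _ _)
    refine ⟨h4.trans_le h3, ?_⟩
    have h5 := Real.logb_le_logb_of_le one_lt_two h4 h3
    have h6 : Real.logb 2 (9 * (695 * k : ℝ) ^ 2) ≤ Real.logb 2 (9 * (1264 * k : ℝ) ^ 2) := by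
      apply Real.logb_le_logb_of_le one_lt_two (by positivity)
      gcongr
      norm_num
    have := mul_le_mul_of_nonneg_left n3 hk'.le
    linarith

-- Used to absorb the polynomial factors from Stirling's formula.
open Filter Topology in
lemma eventually_logb_sq_le {a ε : ℝ} (ha : 0 < a) (hε : 0 < ε) :
    ∀ᶠ k : ℕ in atTop, Real.logb 2 (9 * (a * k : ℝ) ^ 2) ≤ ε * k := by
  have hl : 0 < Real.log 2 := Real.log_pos one_lt_two
  have h1 : Real.log =o[atTop] (id : ℝ → ℝ) := Real.isLittleO_log_id_atTop
  have h2 := (h1.comp_tendsto tendsto_natCast_atTop_atTop).bound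
    (show 0 < ε * Real.log 2 / 4 by positivity)
  have h3 : Tendsto (fun k : ℕ => ε * Real.log 2 / 2 * (k : ℝ)) atTop atTop :=
    tendsto_natCast_atTop_atTop.const_mul_atTop (by positivity)
  filter_upwards [h2, h3.eventually_ge_atTop (Real.log (9 * a ^ 2)), eventually_gt_atTop 0]
    with k hk1 hk2 hk3
  have hk : (0 : ℝ) < k := by exact_mod_cast hk3
  simp only [Function.comp_apply, id, Real.norm_eq_abs, abs_of_pos hk] at hk1
  have hk4 := (le_abs_self _).trans hk1
  rw [Real.logb, div_le_iff₀ hl, mul_pow, ← mul_assoc, Real.log_mul (by positivity) (by positivity),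
    Real.log_pow]
  push_cast
  linarith

/-- Downsets with arbitrarily large doubling `K` that need about `K ^ 1.46601` translates. -/
lemma exists_forall_exists_isDownset :
    ∃ k₀ : ℕ, ∀ k ≥ k₀, ∃ (I : Finset ℕ+) (A : Finset (F2Space I)), A.Nonempty ∧ IsDownset A ∧
      doublingConst A ≤ (2 : ℝ) ^ (313.1246 * k : ℝ) ∧
      ∀ C, CoveredByTranslates A C → (2 : ℝ) ^ (1.46601 * (313.1246 * k) : ℝ) ≤ C := by
  -- The error `0.0001` fits both margins: `77968/249 + 0.0001 < 313.1246` and `1.46601 * 313.1246 <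
  -- 41773/91 - 0.0001`.
  obtain ⟨k₁, hk₁⟩ := Filter.eventually_atTop.1
    (eventually_logb_sq_le (a := 1264) (ε := 0.0001) (by norm_num) (by norm_num))
  refine ⟨max k₁ 1, fun k hk => ?_⟩
  have hlog := hk₁ k (le_trans (le_max_left _ _) hk)
  have hk0 : k ≠ 0 := by
    have := le_trans (le_max_right k₁ 1) hk
    omega
  have hk' : (0 : ℝ) < k := by exact_mod_cast Nat.pos_of_ne_zero hk0
  obtain ⟨I, A, hne, hd, hσ, hC⟩ := exists_originBall_bounds hk0
  refine ⟨I, A, hne, hd, ?_, fun C hcov => ?_⟩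
  · have hpos : 0 < doublingConst A := by
      have h1 := hne.card_pos
      have h2 := (hne.add hne).card_pos
      unfold doublingConst
      positivity
    rw [← Real.logb_le_iff_le_rpow one_lt_two hpos]
    linarith
  · obtain ⟨hC₀, hC₁⟩ := hC C hcov
    rw [← Real.le_logb_iff_rpow_le one_lt_two hC₀]
    linarith

end Examples

/-! ### Existence of the least constant and the final bounds -/

section Main

open Finset

lemma CoveredByTranslates.mono {I : Finset ℕ+} {A : Finset (F2Space I)} {C C' : ℝ}
    (h : CoveredByTranslates A C) (hC : C ≤ C') : CoveredByTranslates A C' := by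
  obtain ⟨V, hV, T, hT, hcov⟩ := h
  exact ⟨V, hV, T, hT.trans hC, hcov⟩

lemma CoveredByTranslates.one_le {I : Finset ℕ+} {A : Finset (F2Space I)} {C : ℝ}
    (h : CoveredByTranslates A C) (hA : A.Nonempty) : 1 ≤ C := by
  obtain ⟨V, hV, T, hT, hcov⟩ := h
  refine le_trans ?_ hT
  obtain ⟨x, hx⟩ := hA
  have := hcov hx
  simp only [Set.mem_iUnion, exists_prop] at this
  obtain ⟨t, ht, -⟩ := this
  exact_mod_cast card_pos.2 ⟨t, ht⟩

lemma one_le_doublingConst {I : Finset ℕ+} {A : Finset (F2Space I)} (hA : A.Nonempty) :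
    1 ≤ doublingConst A := by
  rw [doublingConst, one_le_div (by exact_mod_cast hA.card_pos)]
  exact_mod_cast card_le_card_add_left hA

lemma mem_admissibleConstants (K : ℝ) : 2 * K ^ 46 ∈ admissibleConstants K := by
  intro I A hne hd hK
  refine (coveredByTranslates_of_isDownset hne hd).mono ?_
  have := one_le_doublingConst hne
  gcongr

lemma exists_isDownset_doublingConst_eq_one :
    ∃ (I : Finset ℕ+) (A : Finset (F2Space I)), A.Nonempty ∧ IsDownset A ∧
      doublingConst A = 1 := by
  refine ⟨∅, {0}, singleton_nonempty 0, fun i => absurd i.2 (notMem_empty _), ?_⟩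
  simp [doublingConst]

lemma one_le_of_mem_admissibleConstants {K C : ℝ} (hK : 1 ≤ K) (hC : C ∈ admissibleConstants K) :
    1 ≤ C := by
  obtain ⟨I, A, hne, hd, h⟩ := exists_isDownset_doublingConst_eq_one
  exact (hC I A hne hd (h.trans_le hK)).one_le hne

/-- Since numbers of translates are integers, the infimum of the admissible constants is
attained. -/
lemma isLeast_GD {K : ℝ} (hK : 1 ≤ K) : IsLeast (admissibleConstants K) (GD K) := by
  have hbdd : BddBelow (admissibleConstants K) :=
    ⟨1, fun C hC => one_le_of_mem_admissibleConstants hK hC⟩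
  have hne : (admissibleConstants K).Nonempty := ⟨_, mem_admissibleConstants K⟩
  refine ⟨fun I A hA hd hσ => ?_, fun C hC => csInf_le hbdd hC⟩
  -- An admissible `C` below `⌊GD K⌋ + 1` serves for every downset at once: an integer number of
  -- translates below that is at most `⌊GD K⌋`.
  obtain ⟨C, hC, hlt⟩ := exists_lt_of_csInf_lt hne (Int.lt_floor_add_one (GD K))
  obtain ⟨V, hV, T, hT, hcov⟩ := hC I A hA hd hσ
  refine ⟨V, hV, T, ?_, hcov⟩
  have h1 : ((#T : ℤ) : ℝ) < ((⌊GD K⌋ + 1 : ℤ) : ℝ) := by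
    push_cast
    exact hT.trans_lt hlt
  have h2 : (#T : ℤ) ≤ ⌊GD K⌋ := Int.lt_add_one_iff.1 (Int.cast_lt.1 h1)
  have h3 := Int.le_floor.1 h2
  exact_mod_cast h3

lemma exists_mul_rpow_le_of_mem_admissibleConstants :
    ∃ c : ℝ, 0 < c ∧ ∀ K : ℝ, 1 ≤ K → ∀ C ∈ admissibleConstants K,
      c * K ^ (1.46601 : ℝ) ≤ C := by
  obtain ⟨k₀, hk₀⟩ := exists_forall_exists_isDownset
  -- The exponent covers both the rounding of `log K` down to a multiple of `313.1246` and the range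
  -- `k < k₀`, where the trivial bound `1 ≤ C` is used.
  refine ⟨(2 : ℝ) ^ (-(1.46601 * (313.1246 * (k₀ + 1))) : ℝ), by positivity,
    fun K hK C hC => ?_⟩
  have hK₀ : 0 < K := by linarith
  have hlog : 0 ≤ Real.logb 2 K := Real.logb_nonneg one_lt_two hK
  rw [← Real.rpow_logb two_pos (by norm_num) hK₀, ← Real.rpow_mul zero_le_two,
    ← Real.rpow_add two_pos]
  set k := ⌊Real.logb 2 K / 313.1246⌋₊ with hk
  have hk1 : (k : ℝ) * 313.1246 ≤ Real.logb 2 K := by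
    rw [← le_div_iff₀ (by norm_num)]
    exact Nat.floor_le (by positivity)
  have hk2 : Real.logb 2 K < (k + 1) * 313.1246 := by
    rw [← div_lt_iff₀ (by norm_num)]
    exact Nat.lt_floor_add_one _
  have hk₀' : (0 : ℝ) ≤ k₀ := Nat.cast_nonneg _
  rcases le_or_gt k₀ k with h | h
  · obtain ⟨I, A, hne, hd, hσ, hcov⟩ := hk₀ k h
    refine le_trans ?_ (hcov C (hC I A hne hd (hσ.trans ?_)))
    · apply Real.rpow_le_rpow_of_exponent_le one_le_two
      nlinarith
    · rw [← Real.le_logb_iff_rpow_le one_lt_two hK₀]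
      linarith
  · refine le_trans ?_ (one_le_of_mem_admissibleConstants hK hC)
    apply Real.rpow_le_one_of_one_le_of_nonpos one_le_two
    have : (k : ℝ) + 1 ≤ k₀ := by exact_mod_cast h
    nlinarith

end Main

theorem theorem1p9 :
    ∃ c C : ℝ, 0 < c ∧ 0 < C ∧
      (∀ K : ℝ, 1 ≤ K →
        IsLeast (admissibleConstants K) (GD K) ∧
          c * K ^ (1.46601 : ℝ) ≤ GD K ∧ GD K ≤ C * K ^ (46 : ℕ)) ∧
      (∀ (I : Finset ℕ+) (A : Finset (F2Space I)), A.Nonempty → IsDownset A →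
        CoveredByTranslates A (C * doublingConst A ^ (46 : ℕ))) := by
  obtain ⟨c, hc, h⟩ := exists_mul_rpow_le_of_mem_admissibleConstants
  exact ⟨c, 2, hc, two_pos, fun K hK => ⟨isLeast_GD hK, h K hK _ (isLeast_GD hK).1,
    (isLeast_GD hK).2 (mem_admissibleConstants K)⟩,
    fun I A hne hd => coveredByTranslates_of_isDownset hne hd⟩
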